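/- There are absolute constants $c>0$ and $\varepsilon_0>0$ such that for every $0<\varepsilon<\varepsilon_0$ there is an $n(\varepsilon)$ such that for all $n\ge n(\varepsilon)$ there is a convex body $K\subset\mathbb{R}^n$ (a compact convex set with nonempty interior) of geometric width $1$ with the following property: every intersection $L\subseteq\mathbb{R}^n$ of $m<\infty$ closed halfspaces that satisfies $\Pr_{g\sim N(0,I_n)}[g\in K\,\triangle\,L]\le\varepsilon$ has $m\ge 2^{c/\varepsilon}$. Here $K$ has geometric width at most $r$ if it is an intersection of (possibly infinitely many) halfspaces of the form $\{x : u\cdot x\le r'\}$ with $\|u\|=1$ and $r'\le r$, and its geometric width is the least such $r$. -/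

import Mathlib

open MeasureTheory ProbabilityTheory

/-- The closed halfspace `{x : u · x ≤ r}` of `ℝⁿ`. It is a genuine halfspace when `u ≠ 0`. -/
def halfspace {n : ℕ} (u : EuclideanSpace ℝ (Fin n)) (r : ℝ) : Set (EuclideanSpace ℝ (Fin n)) :=
  {x | inner ℝ u x ≤ r}

/-- `L` is an intersection of `m` halfspaces (`m = 0` gives `L = ℝⁿ`). Normal vectors are nonzero
but need not be normalized, and repetitions are allowed. -/
def IsInterOfHalfspaces {n : ℕ} (m : ℕ) (L : Set (EuclideanSpace ℝ (Fin n))) : Prop :=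
  ∃ (u : Fin m → EuclideanSpace ℝ (Fin n)) (r : Fin m → ℝ),
    (∀ i, u i ≠ 0) ∧ L = ⋂ i, halfspace (u i) (r i)

/-- `K` has geometric width at most `r`: it is an intersection of a family, possibly infinite, of
halfspaces `{x : u · x ≤ r'}` with `‖u‖ = 1` and `r' ≤ r`. The family is the set `T` of the
pairs `(u, r')`. -/
def GeometricWidthLE {n : ℕ} (K : Set (EuclideanSpace ℝ (Fin n))) (r : ℝ) : Prop :=
  ∃ T : Set (EuclideanSpace ℝ (Fin n) × ℝ),
    (∀ p ∈ T, ‖p.1‖ = 1 ∧ p.2 ≤ r) ∧ K = ⋂ p ∈ T, halfspace p.1 p.2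

/-- `K` has geometric width (exactly) `r`: `r` is the least number such that `K` has geometric
width at most `r`. -/
def HasGeometricWidth {n : ℕ} (K : Set (EuclideanSpace ℝ (Fin n))) (r : ℝ) : Prop :=
  IsLeast {s : ℝ | GeometricWidthLE K s} r

/-- A convex body: a compact convex set with nonempty interior. -/
def IsConvexBody {n : ℕ} (K : Set (EuclideanSpace ℝ (Fin n))) : Prop :=
  Convex ℝ K ∧ IsCompact K ∧ (interior K).Nonempty

/-- The Gaussian distance of `K` and `L`: the `N(0, Iₙ)`-probability of the symmetric
difference. -/
noncomputable def gaussianDist {n : ℕ} (K L : Set (EuclideanSpace ℝ (Fin n))) : ℝ :=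
  (stdGaussian (EuclideanSpace ℝ (Fin n))).real (symmDiff K L)

/-! The hard body is a cone over a `k`-dimensional ball, with `k` of order `1/ε²`. Single out one
coordinate `x₀` and a block `P` of `k` coordinates, and require `a * x₀ + |x_P| / √k ≤ 1` with `a ^
2 + 1 / k = 1`. This is an intersection of halfspaces at distance `1` from the origin, yet its slice
at fixed `x₀` is a ball of radius `√k * (1 - a * x₀)` in `ℝᵏ`. For `x₀` in an interval `[0, δ]` with
`δ` of order `1/√k`, the radius is within a constant of `√k`. This event has probability of order
`1/√k`, hence of order `ε`. If `L` has too few facets, it misses each of these balls by a constant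
`η`, and Fubini gives total distance above `ε` (`le_gaussianDist_truncatedCone`). Two further
constraints only make the body compact; they are inactive on most of the slices used.

It remains to see that a ball of radius about `√k` needs `m ≥ exp (Ω(√k))` facets
(`exists_ball_approximation_bound`). The test functional is `∫_L (k - ‖x‖²)` against the Gaussian
measure, which is the derivative of the measure of `t • L` at `t = 1`. For the ball it is nearly the
mean of the positive part of `k - ‖x‖²`, of order `√k` by comparing second and fourth moments
(`exists_le_integral_pos_part`). It changes little when the ball is replaced by a set at small
Gaussian distance.

For an intersection of `m` halfspaces it is `O(1 + log m)`, because dilating by `t` adds measure at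
most `O((t - 1)(1 + log m))` (`stdGaussian_dilation_polyhedron_le`). Facets farther than `R = 2√(log
m)` from the origin are handled by the Gaussian tail and a union bound. For nearer facets, the added
layer has thickness at most `(t - 1) * R`, and pushing it along the outer normals, which do not
collide, bounds the total by a surface-area estimate of order `R`. -/

/-! ### Density, translations, marginals and dilations of the standard Gaussian measure. -/

section GaussianDensity

variable {E : Type*} [NormedAddCommGroup E] [InnerProductSpace ℝ E]

/-- The density of the standard Gaussian measure with respect to Lebesgue measure. -/
noncomputable def stdGaussianPDF (x : E) : ℝ :=
  (2 * Real.pi) ^ (-(Module.finrank ℝ E : ℝ) / 2) * Real.exp (-‖x‖ ^ 2 / 2)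

lemma stdGaussianPDF_nonneg (x : E) : 0 ≤ stdGaussianPDF x := by
  unfold stdGaussianPDF; positivity

lemma continuous_stdGaussianPDF : Continuous (stdGaussianPDF : E → ℝ) := by
  unfold stdGaussianPDF; fun_prop

variable [FiniteDimensional ℝ E] [MeasurableSpace E] [BorelSpace E]

lemma integrable_stdGaussianPDF : Integrable (stdGaussianPDF : E → ℝ) := by
  have h := GaussianFourier.integrable_cexp_neg_mul_sq_norm_add (V := E) (b := 1 / 2)
    (by norm_num) 0 0
  have h2 := h.norm.const_mul ((2 * Real.pi) ^ (-(Module.finrank ℝ E : ℝ) / 2))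
  refine h2.congr (Filter.Eventually.of_forall fun x => ?_)
  simp only [stdGaussianPDF, Complex.norm_exp]
  congr 2
  simp [← Complex.ofReal_pow]
  ring

lemma stdGaussian_eq_withDensity :
    stdGaussian E = volume.withDensity (fun x => ENNReal.ofReal (stdGaussianPDF x)) := by
  have : IsFiniteMeasure (volume.withDensity (fun x : E => ENNReal.ofReal (stdGaussianPDF x))) :=
    isFiniteMeasure_withDensity_ofReal integrable_stdGaussianPDF.2
  apply Measure.ext_of_charFun
  ext t
  rw [charFun_stdGaussian, charFun_apply, integral_withDensity_eq_integral_toReal_smul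
    (by exact continuous_stdGaussianPDF.measurable.ennreal_ofReal) (by simp)]
  have h := GaussianFourier.integral_cexp_neg_mul_sq_norm_add (V := E) (b := 1 / 2)
    (by norm_num) Complex.I t
  have e : ∀ x : E, (ENNReal.ofReal (stdGaussianPDF x)).toReal •
      Complex.exp (((inner ℝ x t : ℝ) : ℂ) * Complex.I) =
      (((2 * Real.pi) ^ (-(Module.finrank ℝ E : ℝ) / 2) : ℝ) : ℂ) *
        Complex.exp (-(1 / 2) * ‖x‖ ^ 2 + Complex.I * (inner ℝ t x : ℝ)) := by
    intro x
    rw [ENNReal.toReal_ofReal (stdGaussianPDF_nonneg x), Complex.real_smul, stdGaussianPDF,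
      Complex.ofReal_mul, mul_assoc, Complex.ofReal_exp, ← Complex.exp_add, real_inner_comm]
    congr 2
    push_cast
    ring
  simp_rw [e]
  rw [integral_const_mul, h]
  have h1 : ((Real.pi : ℂ) / (1 / 2)) ^ ((Module.finrank ℝ E : ℂ) / 2) =
      (((2 * Real.pi) ^ ((Module.finrank ℝ E : ℝ) / 2) : ℝ) : ℂ) := by
    rw [Complex.ofReal_cpow (by positivity)]
    push_cast
    congr 1
    ring
  rw [h1, ← mul_assoc, ← Complex.ofReal_mul, ← Real.rpow_add (by positivity)]
  simp only [neg_div, neg_add_cancel, Real.rpow_zero, Complex.ofReal_one, one_mul]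
  congr 1
  simp
  ring

lemma lintegral_stdGaussian {f : E → ENNReal} (hf : Measurable f) :
    ∫⁻ x, f x ∂(stdGaussian E) = ∫⁻ x, ENNReal.ofReal (stdGaussianPDF x) * f x := by
  rw [stdGaussian_eq_withDensity, lintegral_withDensity_eq_lintegral_mul _
    (by exact continuous_stdGaussianPDF.measurable.ennreal_ofReal) hf]
  rfl

/-- Translating a set which lies in `{x | inner u x ≤ p}` by `s • u` decreases its Gaussian measure
by at most the factor `exp (-s p - s² / 2)`. -/
lemma stdGaussian_le_translate {T : Set E} (hT : MeasurableSet T) {u : E} (hu : ‖u‖ = 1)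
    {p s : ℝ} (hs : 0 ≤ s) (hTp : ∀ x ∈ T, inner ℝ u x ≤ p) :
    ENNReal.ofReal (Real.exp (-s * p - s ^ 2 / 2)) * stdGaussian E T ≤
      stdGaussian E ((fun z => z - s • u) ⁻¹' T) := by
  have hm : Measurable (fun z : E => z - s • u) := by fun_prop
  rw [← lintegral_indicator_one hT, ← lintegral_indicator_one (hm hT),
    lintegral_stdGaussian (measurable_one.indicator hT),
    lintegral_stdGaussian (measurable_one.indicator (hm hT)),
    ← lintegral_const_mul' _ _ ENNReal.ofReal_ne_top,
    ← lintegral_add_right_eq_self (μ := (volume : Measure E))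
      (fun z => ENNReal.ofReal (stdGaussianPDF z) * ((fun z => z - s • u) ⁻¹' T).indicator 1 z) (s • u)]
  refine lintegral_mono fun x => ?_
  by_cases hx : x ∈ T
  · have h2 : x + s • u ∈ ((fun z => z - s • u) ⁻¹' T) := by simpa using hx
    simp only [Set.indicator_of_mem hx, Set.indicator_of_mem h2, Pi.one_apply, mul_one]
    rw [← ENNReal.ofReal_mul (Real.exp_nonneg _)]
    apply ENNReal.ofReal_le_ofReal
    unfold stdGaussianPDF
    rw [mul_left_comm, ← Real.exp_add]
    gcongr
    rw [norm_add_sq_real, norm_smul, hu, inner_smul_right, real_inner_comm, Real.norm_eq_abs,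
      abs_of_nonneg hs]
    nlinarith [mul_le_mul_of_nonneg_left (hTp x hx) hs]
  · simp [Set.indicator_of_notMem hx]

/-- The one-dimensional marginals of the standard Gaussian measure. -/
lemma stdGaussian_map_inner (u : E) :
    (stdGaussian E).map (fun x => inner ℝ u x) = gaussianReal 0 (‖u‖₊ ^ 2) := by
  apply Measure.ext_of_charFun
  ext t
  rw [charFun_gaussianReal, charFun_apply_real, integral_map (by fun_prop)
    (by fun_prop)]
  have := charFun_stdGaussian (t • u)
  rw [charFun_apply] at this
  simp only [inner_smul_right, norm_smul, real_inner_comm u] at this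
  push_cast at this ⊢
  rw [this]
  congr 1
  simp only [mul_zero, zero_mul, zero_sub, ← neg_div, mul_pow]
  congr 2
  rw [mul_comm, ← Complex.ofReal_pow (‖t‖)]
  simp

/-- The Gaussian measure of a dilation of `L`, as an integral over `L`. -/
lemma stdGaussian_preimage_smul {S : Set E} (hS : MeasurableSet S) {t : ℝ} (ht : 0 < t) :
    (stdGaussian E).real ((fun x => t⁻¹ • x) ⁻¹' S) =
      ∫ x in S, t ^ (Module.finrank ℝ E) * Real.exp (-(t ^ 2 - 1) * ‖x‖ ^ 2 / 2)
        ∂(stdGaussian E) := by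
  have hm : Measurable (fun z : E => t⁻¹ • z) := by fun_prop
  rw [← integral_indicator_one (hm hS), ← integral_indicator hS, stdGaussian_eq_withDensity,
    integral_withDensity_eq_integral_toReal_smul
    (by exact continuous_stdGaussianPDF.measurable.ennreal_ofReal) (by simp),
    integral_withDensity_eq_integral_toReal_smul
    (by exact continuous_stdGaussianPDF.measurable.ennreal_ofReal) (by simp)]
  have h := Measure.integral_comp_smul_of_nonneg (volume : Measure E)
    (fun z : E => (ENNReal.ofReal (stdGaussianPDF z)).toReal •
      ((fun x => t⁻¹ • x) ⁻¹' S).indicator (1 : E → ℝ) z) t (hR := ht.le)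
  rw [smul_eq_mul, inv_mul_eq_div, eq_div_iff (by positivity), mul_comm] at h
  rw [← h, ← integral_const_mul]
  refine integral_congr_ae (Filter.Eventually.of_forall fun x => ?_)
  simp only [ENNReal.toReal_ofReal (stdGaussianPDF_nonneg _), smul_eq_mul]
  by_cases hx : x ∈ S
  · have h2 : t • x ∈ ((fun z => t⁻¹ • z) ⁻¹' S) := by
      simpa [smul_smul, inv_mul_cancel₀ ht.ne'] using hx
    rw [Set.indicator_of_mem hx, Set.indicator_of_mem h2, Pi.one_apply, mul_one]
    unfold stdGaussianPDF
    rw [mul_left_comm, mul_left_comm (_ * _), mul_assoc, ← Real.exp_add, norm_smul,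
      Real.norm_eq_abs, abs_of_pos ht]
    have e : -(t * ‖x‖) ^ 2 / 2 = -‖x‖ ^ 2 / 2 + -(t ^ 2 - 1) * ‖x‖ ^ 2 / 2 := by ring
    rw [e]
    ring
  · have h2 : t • x ∉ ((fun z => t⁻¹ • z) ⁻¹' S) := by
      simpa [smul_smul, inv_mul_cancel₀ ht.ne'] using hx
    simp [Set.indicator_of_notMem hx, Set.indicator_of_notMem h2]

end GaussianDensity

/-! ### Gaussian measure of the layer added by dilating a polyhedron. -/

section Polyhedra

variable {E : Type*} [NormedAddCommGroup E] [InnerProductSpace ℝ E]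

/-- The intersection of the halfspaces `{x | inner (u i) x ≤ r i}`. -/
def polyhedron {m : ℕ} (u : Fin m → E) (r : Fin m → ℝ) : Set E :=
  {x | ∀ i, inner ℝ (u i) x ≤ r i}

/-- The points outside the polyhedron that violate the `i`-th inequality the most (with ties broken
by the order of the indices), but satisfy its `t`-fold dilation. -/
def facetSlab {m : ℕ} (u : Fin m → E) (r : Fin m → ℝ) (t : ℝ) (i : Fin m) : Set E :=
  {x | r i < inner ℝ (u i) x ∧ inner ℝ (u i) x ≤ t * r i ∧
    (∀ j, inner ℝ (u j) x - r j ≤ inner ℝ (u i) x - r i) ∧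
    ∀ j < i, inner ℝ (u j) x - r j < inner ℝ (u i) x - r i}

lemma diff_polyhedron_subset {m : ℕ} (u : Fin m → E) (r : Fin m → ℝ) {t : ℝ} (ht : 0 < t) :
    ((fun x => t⁻¹ • x) ⁻¹' polyhedron u r) \ polyhedron u r ⊆ ⋃ i, facetSlab u r t i := by
  rintro x ⟨hx, hx'⟩
  simp only [polyhedron, Set.mem_ofPred_eq, not_forall, not_le, Set.mem_preimage,
    inner_smul_right] at hx hx'
  obtain ⟨i₀, hi₀⟩ := hx'
  let f : Fin m → ℝ := fun j => inner ℝ (u j) x - r j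
  let s : Finset (Fin m) := Finset.univ.filter fun i => ∀ j, f j ≤ f i
  have hs : s.Nonempty := by
    obtain ⟨i, -, hi⟩ := Finset.exists_max_image Finset.univ f ⟨i₀, Finset.mem_univ _⟩
    exact ⟨i, by simpa [s] using hi⟩
  have hmem : ∀ j, f j ≤ f (s.min' hs) := by
    have := s.min'_mem hs
    simpa [s] using this
  refine Set.mem_iUnion.2 ⟨s.min' hs, ?_, ?_, hmem, ?_⟩
  · have : f i₀ ≤ f (s.min' hs) := hmem i₀
    simp only [f] at this
    linarith
  · have := hx (s.min' hs)
    rwa [inv_mul_le_iff₀ ht] at this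
  · intro j hj
    by_contra hcon
    have hjs : j ∈ s := by
      simp only [s, Finset.mem_filter, Finset.mem_univ, true_and]
      intro l
      exact (hmem l).trans (not_lt.1 hcon)
    exact absurd (s.min'_le j hjs) (not_le.2 hj)

/-- The outer normal rays of the facets of a polyhedron are disjoint. -/
lemma facetSlab_index_unique {m : ℕ} {u : Fin m → E} {r : Fin m → ℝ} {t : ℝ} {i j : Fin m}
    {z : E} {a b : ℝ} (ha : 0 ≤ a) (hb : 0 ≤ b) (hi : z - a • u i ∈ facetSlab u r t i)
    (hj : z - b • u j ∈ facetSlab u r t j)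
    (h : inner ℝ (u i) (z - a • u i) - r i = inner ℝ (u j) (z - b • u j) - r j) : i = j := by
  set x := z - a • u i with hx
  set y := z - b • u j with hy
  obtain ⟨-, -, hi1, hi2⟩ := hi
  obtain ⟨-, -, hj1, hj2⟩ := hj
  have h1 : inner ℝ (a • u i) (y - x) ≤ 0 := by
    rw [inner_smul_left, inner_sub_right]
    have := hj1 i
    exact mul_nonpos_of_nonneg_of_nonpos ha (by linarith)
  have h2 : inner ℝ (b • u j) (x - y) ≤ 0 := by
    rw [inner_smul_left, inner_sub_right]
    have := hi1 j
    exact mul_nonpos_of_nonneg_of_nonpos hb (by linarith)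
  have e1 : a • u i = z - x := by rw [hx]; abel
  have e2 : b • u j = z - y := by rw [hy]; abel
  -- Both `x` and `y` are the metric projection of `z` onto the convex set where every excess `inner
  -- (u l) · - r l` is at most the common value in `h`. Their variational inequalities `h1` and `h2`
  -- add up to this.
  have h3 : inner ℝ (y - x) (y - x) ≤ 0 := by
    have : inner ℝ (y - x) (y - x) = inner ℝ (a • u i) (y - x) + inner ℝ (b • u j) (x - y) := by
      rw [e1, e2, ← neg_sub y x, inner_neg_right, ← sub_eq_add_neg, ← inner_sub_left]
      congr 1
      abel
    linarith
  have hxy : y = x := sub_eq_zero.1 (real_inner_self_nonpos.1 h3)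
  rw [hxy] at hj1 hj2
  rcases lt_trichotomy i j with hlt | heq | hgt
  · exact absurd (hi1 j) (not_le.2 (hj2 i hlt))
  · exact heq
  · exact absurd (hj1 i) (not_le.2 (hi2 j hgt))

/-- Zero normals cannot be excluded, since restricting a normal vector to a block of coordinates may
kill it. -/
lemma facetSlab_eq_empty {m : ℕ} {u : Fin m → E} {r : Fin m → ℝ} {t : ℝ} (ht : 1 ≤ t) {i : Fin m}
    (hi : u i = 0) : facetSlab u r t i = ∅ := by
  refine Set.eq_empty_of_forall_notMem ?_
  rintro x ⟨h1, h2, -⟩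
  rw [hi, inner_zero_left] at h1 h2
  nlinarith

variable [MeasurableSpace E] [BorelSpace E] [FiniteDimensional ℝ E]

lemma measurableSet_polyhedron {m : ℕ} (u : Fin m → E) (r : Fin m → ℝ) :
    MeasurableSet (polyhedron u r) := by
  rw [polyhedron, Set.ofPred_forall]
  exact MeasurableSet.iInter fun i => measurableSet_le (by fun_prop) (by fun_prop)

lemma measurableSet_facetSlab {m : ℕ} (u : Fin m → E) (r : Fin m → ℝ) (t : ℝ) (i : Fin m) :
    MeasurableSet (facetSlab u r t i) := by
  simp only [facetSlab, Set.ofPred_and, Set.ofPred_forall]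
  exact (measurableSet_lt (by fun_prop) (by fun_prop)).inter
    ((measurableSet_le (by fun_prop) (by fun_prop)).inter
      ((MeasurableSet.iInter fun j => measurableSet_le (by fun_prop) (by fun_prop)).inter
        (MeasurableSet.iInter fun j => MeasurableSet.iInter fun _ =>
          measurableSet_lt (by fun_prop) (by fun_prop))))

/-- Along the inward ray from `z`, the excess over the `i`-th inequality is an affine parameter of
unit speed. By `facetSlab_index_unique` each value of the excess is used by at most one index, and
inside the slabs the excess lies in `(0, (t - 1) * R]`. -/
lemma sum_volume_facetSlab_le {m : ℕ} (u : Fin m → E) (r : Fin m → ℝ) {t R σ : ℝ} (ht : 1 ≤ t)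
    (J : Finset (Fin m)) (hJ : ∀ i ∈ J, r i ≤ R) (hu : ∀ i ∈ J, ‖u i‖ = 1) (z : E) :
    ∑ i ∈ J, (volume.restrict (Set.Ioc 0 σ)) {s : ℝ | z - s • u i ∈ facetSlab u r t i} ≤
      ENNReal.ofReal ((t - 1) * R) := by
  -- Reparametrise `s` by the excess `d` of the point `z - s • u i`, so that different indices
  -- become comparable.
  let D : Fin m → Set ℝ := fun i => (fun d => inner ℝ (u i) z - r i - d) ⁻¹'
    ({s : ℝ | z - s • u i ∈ facetSlab u r t i} ∩ Set.Ioc 0 σ)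
  have hmeas : ∀ i, MeasurableSet {s : ℝ | z - s • u i ∈ facetSlab u r t i} := fun i =>
    (by fun_prop : Measurable fun s : ℝ => z - s • u i) (measurableSet_facetSlab u r t i)
  have hDm : ∀ i, MeasurableSet (D i) := fun i =>
    (by fun_prop : Measurable fun d : ℝ => inner ℝ (u i) z - r i - d)
      ((hmeas i).inter measurableSet_Ioc)
  have hex : ∀ i ∈ J, ∀ d, inner ℝ (u i) (z - (inner ℝ (u i) z - r i - d) • u i) - r i = d := by
    intro i hi d
    rw [inner_sub_right, inner_smul_right, real_inner_self_eq_norm_sq, hu i hi]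
    ring
  calc ∑ i ∈ J, (volume.restrict (Set.Ioc 0 σ)) {s : ℝ | z - s • u i ∈ facetSlab u r t i}
      = ∑ i ∈ J, volume (D i) := by
        refine Finset.sum_congr rfl fun i _ => ?_
        rw [Measure.restrict_apply (hmeas i)]
        exact ((Measure.measurePreserving_sub_left volume (inner ℝ (u i) z - r i)).measure_preimage
          ((hmeas i).inter measurableSet_Ioc).nullMeasurableSet).symm
    _ = volume (⋃ i ∈ J, D i) := by
        refine (measure_biUnion_finset (fun i hi j hj hij => ?_) fun i _ => hDm i).symm
        refine Set.disjoint_left.2 fun d hdi hdj => hij ?_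
        refine facetSlab_index_unique hdi.2.1.le hdj.2.1.le hdi.1 hdj.1 ?_
        rw [hex i hi, hex j hj]
    _ ≤ volume (Set.Ioc 0 ((t - 1) * R)) := by
        refine measure_mono (Set.iUnion₂_subset fun i hi d hd => ?_)
        obtain ⟨h1, h2, -⟩ := hd.1
        have := hex i hi d
        have := hJ i hi
        constructor
        · linarith
        · nlinarith
    _ = _ := by simp

/-- Push each slab outwards by every `s ∈ (0, σ]` and integrate over `s`. The Gaussian measure drops
by at most a constant factor, while by Fubini the integrated measure of all translates is at most
`(t - 1) * R`. -/
lemma sum_stdGaussian_facetSlab_le {m : ℕ} (u : Fin m → E) (r : Fin m → ℝ) {t R : ℝ} (ht : 1 ≤ t)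
    (hR : 0 ≤ R)
    (J : Finset (Fin m)) (hJ : ∀ i ∈ J, r i ≤ R) (hu : ∀ i ∈ J, ‖u i‖ = 1) :
    ∑ i ∈ J, stdGaussian E (facetSlab u r t i) ≤
      ENNReal.ofReal (Real.exp 2 * (t * R + 1) * ((t - 1) * R)) := by
  -- The slabs lie in `inner u x ≤ t * R`, so `s ≤ σ` keeps the loss `exp (-s * (t * R) - s ^ 2 /
  -- 2)` above `exp (-2)`.
  set σ : ℝ := (t * R + 1)⁻¹ with hσ
  have htR : 0 ≤ t * R := by positivity
  have hσ0 : 0 < σ := by positivity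
  have hσ1 : σ ≤ 1 := inv_le_one_of_one_le₀ (by linarith)
  have hσR : σ * (t * R) ≤ 1 := by
    rw [hσ, inv_mul_le_iff₀ (by positivity)]; linarith
  have key : ∀ i ∈ J, ENNReal.ofReal (Real.exp (-2) * σ) * stdGaussian E (facetSlab u r t i) ≤
      ∫⁻ z, (volume.restrict (Set.Ioc 0 σ)) {s : ℝ | z - s • u i ∈ facetSlab u r t i}
        ∂(stdGaussian E) := by
    intro i hi
    have hT := measurableSet_facetSlab u r t i
    have hset : MeasurableSet {q : ℝ × E | q.2 - q.1 • u i ∈ facetSlab u r t i} :=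
      (by fun_prop : Measurable fun q : ℝ × E => q.2 - q.1 • u i) hT
    have e : ∫⁻ z, (volume.restrict (Set.Ioc 0 σ)) {s : ℝ | z - s • u i ∈ facetSlab u r t i}
        ∂(stdGaussian E) = ∫⁻ s in Set.Ioc 0 σ,
          stdGaussian E ((fun z => z - s • u i) ⁻¹' facetSlab u r t i) := by
      exact (Measure.prod_apply_symm (μ := volume.restrict (Set.Ioc 0 σ)) hset).symm.trans
        (Measure.prod_apply hset)
    rw [e]
    calc ENNReal.ofReal (Real.exp (-2) * σ) * stdGaussian E (facetSlab u r t i)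
        = ∫⁻ s in Set.Ioc 0 σ, ENNReal.ofReal (Real.exp (-2)) *
            stdGaussian E (facetSlab u r t i) := by
          rw [setLIntegral_const, Real.volume_Ioc, sub_zero, ENNReal.ofReal_mul (by positivity)]
          ring
      _ ≤ _ := by
          refine setLIntegral_mono' measurableSet_Ioc fun s hs => ?_
          refine le_trans ?_ (stdGaussian_le_translate hT (hu i hi) hs.1.le (p := t * R) ?_)
          · gcongr
            have : s * (t * R) ≤ σ * (t * R) := by gcongr; exact hs.2
            have h3 : s ≤ 1 := hs.2.trans hσ1
            nlinarith [hs.1]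
          · rintro x ⟨-, h2, -⟩
            have := hJ i hi
            nlinarith
  have hsum : ENNReal.ofReal (Real.exp (-2) * σ) * ∑ i ∈ J, stdGaussian E (facetSlab u r t i) ≤
      ENNReal.ofReal ((t - 1) * R) := by
    rw [Finset.mul_sum]
    refine (Finset.sum_le_sum key).trans ?_
    rw [← lintegral_finsetSum]
    · refine (lintegral_mono fun z => sum_volume_facetSlab_le u r ht J hJ hu z).trans ?_
      simp
    · intro i _
      have hset : MeasurableSet {q : ℝ × E | q.2 - q.1 • u i ∈ facetSlab u r t i} :=
        (by fun_prop : Measurable fun q : ℝ × E => q.2 - q.1 • u i)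
          (measurableSet_facetSlab u r t i)
      exact measurable_measure_prodMk_right hset
  calc ∑ i ∈ J, stdGaussian E (facetSlab u r t i)
      = ENNReal.ofReal (Real.exp 2 * (t * R + 1)) * (ENNReal.ofReal (Real.exp (-2) * σ) *
          ∑ i ∈ J, stdGaussian E (facetSlab u r t i)) := by
        rw [← mul_assoc, ← ENNReal.ofReal_mul (by positivity)]
        have : Real.exp 2 * (t * R + 1) * (Real.exp (-2) * σ) = 1 := by
          rw [hσ, Real.exp_neg]
          field_simp
        rw [this]; simp
    _ ≤ ENNReal.ofReal (Real.exp 2 * (t * R + 1)) * ENNReal.ofReal ((t - 1) * R) := by gcongr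
    _ = _ := by rw [← ENNReal.ofReal_mul (by positivity)]

/-- The slab has length `(t - 1) * r` and density at most `exp (-r ^ 2 / 2)`. Half of the exponent
absorbs the factor `r`, leaving a bound that decreases in `r`. -/
lemma stdGaussian_slab_le {u : E} (hu : ‖u‖ = 1) {r t : ℝ} (hr : 0 ≤ r) (ht : 1 ≤ t) :
    stdGaussian E {x | r < inner ℝ u x ∧ inner ℝ u x ≤ t * r} ≤
      ENNReal.ofReal ((t - 1) * Real.exp (-r ^ 2 / 4)) := by
  have e : stdGaussian E {x | r < inner ℝ u x ∧ inner ℝ u x ≤ t * r} =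
      gaussianReal 0 1 (Set.Ioc r (t * r)) := by
    have h := stdGaussian_map_inner u
    have h1 : ‖u‖₊ = 1 := by ext; simpa using hu
    rw [h1, one_pow] at h
    rw [← h, Measure.map_apply (by fun_prop) measurableSet_Ioc]
    rfl
  rw [e, gaussianReal_apply _ one_ne_zero]
  calc ∫⁻ x in Set.Ioc r (t * r), gaussianPDF 0 1 x
      ≤ ∫⁻ x in Set.Ioc r (t * r), ENNReal.ofReal (Real.exp (-r ^ 2 / 2)) := by
        refine setLIntegral_mono' measurableSet_Ioc fun x hx => ?_
        unfold gaussianPDF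
        apply ENNReal.ofReal_le_ofReal
        rw [gaussianPDFReal]
        have h1 : (√(2 * Real.pi * (1 : NNReal)))⁻¹ ≤ 1 := by
          apply inv_le_one_of_one_le₀
          rw [Real.one_le_sqrt]
          have := Real.pi_gt_three
          push_cast
          linarith
        have h2 : Real.exp (-(x - 0) ^ 2 / (2 * (1 : NNReal))) ≤ Real.exp (-r ^ 2 / 2) := by
          rw [Real.exp_le_exp]
          push_cast
          nlinarith [hx.1]
        calc _ ≤ 1 * Real.exp (-r ^ 2 / 2) := by gcongr
          _ = _ := one_mul _
    _ = ENNReal.ofReal (Real.exp (-r ^ 2 / 2) * ((t - 1) * r)) := by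
        rw [setLIntegral_const, Real.volume_Ioc, ENNReal.ofReal_mul (by positivity)]
        congr 2
        ring
    _ ≤ _ := by
        apply ENNReal.ofReal_le_ofReal
        have h3 : r ≤ Real.exp (r ^ 2 / 4) := by
          have := Real.add_one_le_exp (r ^ 2 / 4)
          nlinarith [sq_nonneg (r / 2 - 1)]
        have h4 : Real.exp (-r ^ 2 / 2) * Real.exp (r ^ 2 / 4) = Real.exp (-r ^ 2 / 4) := by
          rw [← Real.exp_add]; congr 1; ring
        rw [← h4]
        calc _ = (t - 1) * (Real.exp (-r ^ 2 / 2) * r) := by ring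
          _ ≤ _ := by
            have : 0 ≤ t - 1 := by linarith
            gcongr

/-- Dilating an intersection of `m` halfspaces by `t ≥ 1` increases its Gaussian measure by
`O((t - 1) log m)`. -/
lemma stdGaussian_dilation_polyhedron_le {m : ℕ} (u : Fin m → E) (r : Fin m → ℝ)
    (hu : ∀ i, ‖u i‖ = 1 ∨ u i = 0) {t : ℝ} (ht : 1 ≤ t) {R : ℝ} (hR : R = 2 * √(Real.log m)) :
    (stdGaussian E).real ((fun x => t⁻¹ • x) ⁻¹' polyhedron u r) ≤
      (stdGaussian E).real (polyhedron u r) +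
        (t - 1) * (Real.exp 2 * (t * R + 1) * R + 1) := by
  have hR0 : 0 ≤ R := by rw [hR]; positivity
  have ht0 : 0 ≤ t - 1 := by linarith
  -- This determines the choice of `R`: the tails of all `m` far facets together cost at most one
  -- facet's worth.
  have hRm : (m : ℝ) * Real.exp (-R ^ 2 / 4) ≤ 1 := by
    rcases Nat.eq_zero_or_pos m with hm | hm
    · simp [hm]
    · have hm1 : (1 : ℝ) ≤ m := by exact_mod_cast hm
      have : -R ^ 2 / 4 = -Real.log m := by
        rw [hR, mul_pow, Real.sq_sqrt (Real.log_nonneg hm1)]; ring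
      rw [this, Real.exp_neg, Real.exp_log (by linarith), mul_inv_cancel₀ (by linarith)]
  classical
  -- `A` holds the near facets, treated by the surface-area argument; `B` holds the far ones,
  -- treated by the tail, and the zero normals, whose slabs are empty.
  let A : Finset (Fin m) := Finset.univ.filter fun i => r i ≤ R ∧ u i ≠ 0
  let B : Finset (Fin m) := Finset.univ.filter fun i => ¬ (r i ≤ R ∧ u i ≠ 0)
  have hA : ∑ i ∈ A, stdGaussian E (facetSlab u r t i) ≤
      ENNReal.ofReal (Real.exp 2 * (t * R + 1) * ((t - 1) * R)) := by
    apply sum_stdGaussian_facetSlab_le u r ht hR0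
    · intro i hi
      simp only [A, Finset.mem_filter] at hi
      exact hi.2.1
    · intro i hi
      simp only [A, Finset.mem_filter] at hi
      exact (hu i).resolve_right hi.2.2
  have hB : ∑ i ∈ B, stdGaussian E (facetSlab u r t i) ≤ ENNReal.ofReal (t - 1) := by
    have : ∀ i ∈ B, stdGaussian E (facetSlab u r t i) ≤
        ENNReal.ofReal ((t - 1) * Real.exp (-R ^ 2 / 4)) := by
      intro i hi
      simp only [B, Finset.mem_filter, Finset.mem_univ, true_and] at hi
      by_cases h0 : u i = 0
      · rw [facetSlab_eq_empty ht h0]; simp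
      · have hri : R < r i := by
          by_contra hcon
          exact hi ⟨not_lt.1 hcon, h0⟩
        refine (measure_mono ?_).trans ((stdGaussian_slab_le ((hu i).resolve_right h0)
          (hR0.trans hri.le) ht).trans ?_)
        · rintro x ⟨h1, h2, -⟩
          exact ⟨h1, h2⟩
        · gcongr
    refine (Finset.sum_le_card_nsmul _ _ _ this).trans ?_
    have hcard : (B.card : ENNReal) ≤ m := by
      have := Finset.card_le_univ B
      rw [Fintype.card_fin] at this
      exact_mod_cast this
    rw [nsmul_eq_mul]
    calc (B.card : ENNReal) * ENNReal.ofReal ((t - 1) * Real.exp (-R ^ 2 / 4))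
        ≤ (m : ENNReal) * ENNReal.ofReal ((t - 1) * Real.exp (-R ^ 2 / 4)) := by gcongr
      _ = ENNReal.ofReal ((t - 1) * (m * Real.exp (-R ^ 2 / 4))) := by
          rw [← ENNReal.ofReal_natCast, ← ENNReal.ofReal_mul (by positivity)]
          congr 1; ring
      _ ≤ _ := ENNReal.ofReal_le_ofReal (mul_le_of_le_one_right ht0 hRm)
  have hbound : 0 ≤ (t - 1) * (Real.exp 2 * (t * R + 1) * R + 1) := by
    have : 0 ≤ t := by linarith
    positivity
  have htot : stdGaussian E ((fun x => t⁻¹ • x) ⁻¹' polyhedron u r) ≤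
      stdGaussian E (polyhedron u r) +
        ENNReal.ofReal ((t - 1) * (Real.exp 2 * (t * R + 1) * R + 1)) := by
    calc stdGaussian E ((fun x => t⁻¹ • x) ⁻¹' polyhedron u r)
        ≤ stdGaussian E (polyhedron u r ∪
            (((fun x => t⁻¹ • x) ⁻¹' polyhedron u r) \ polyhedron u r)) :=
          measure_mono (by rw [Set.union_sdiff_self]; exact Set.subset_union_right)
      _ ≤ stdGaussian E (polyhedron u r) + stdGaussian E (⋃ i, facetSlab u r t i) :=
          (measure_union_le _ _).trans
            (by gcongr; exact diff_polyhedron_subset u r (by linarith))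
      _ ≤ stdGaussian E (polyhedron u r) + ∑ i, stdGaussian E (facetSlab u r t i) := by
          gcongr
          exact measure_iUnion_fintype_le _ _
      _ = stdGaussian E (polyhedron u r) + (∑ i ∈ A, stdGaussian E (facetSlab u r t i) +
            ∑ i ∈ B, stdGaussian E (facetSlab u r t i)) := by
          rw [Finset.sum_filter_add_sum_filter_not]
      _ ≤ stdGaussian E (polyhedron u r) + (ENNReal.ofReal (Real.exp 2 * (t * R + 1) *
            ((t - 1) * R)) + ENNReal.ofReal (t - 1)) := by gcongr
      _ = _ := by
          rw [← ENNReal.ofReal_add (by positivity) ht0]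
          congr 2
          ring
  have := ENNReal.toReal_mono (by finiteness) htot
  rwa [ENNReal.toReal_add (by finiteness) (by finiteness), ENNReal.toReal_ofReal hbound] at this

end Polyhedra

/-! ### The dilation bound differentiated at `t = 1`. -/

section SecondMoment

variable {E : Type*} [NormedAddCommGroup E] [InnerProductSpace ℝ E]
  [MeasurableSpace E] [BorelSpace E] [FiniteDimensional ℝ E]

lemma integrable_norm_sq_stdGaussian : Integrable (fun x : E => ‖x‖ ^ 2) (stdGaussian E) := by
  simpa using (IsGaussian.memLp_two_id (μ := stdGaussian E)).integrable_norm_pow (p := 2) (by simp)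

/-- The dimension minus the mean square norm is `O(1 + log m)` on an intersection of `m`
halfspaces. -/
lemma integral_polyhedron_finrank_sub_norm_sq_le {m : ℕ} (u : Fin m → E) (r : Fin m → ℝ)
    (hu : ∀ i, ‖u i‖ = 1 ∨ u i = 0) {R : ℝ} (hR : R = 2 * √(Real.log m)) :
    ∫ x in polyhedron u r, ((Module.finrank ℝ E : ℝ) - ‖x‖ ^ 2) ∂(stdGaussian E) ≤
      Real.exp 2 * (R + 1) * R + 1 := by
  set k := Module.finrank ℝ E with hk
  set μ := (stdGaussian E).restrict (polyhedron u r) with hμ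
  have hint : Integrable (fun x : E => ‖x‖ ^ 2) μ := integrable_norm_sq_stdGaussian.restrict
  set p := (stdGaussian E).real (polyhedron u r) with hp
  set Q := ∫ x, ‖x‖ ^ 2 ∂μ with hQ
  have hp' : ∫ _, (1 : ℝ) ∂μ = p := by simp [hμ, hp, measureReal_def]
  have hQ0 : 0 ≤ Q := integral_nonneg fun x => by positivity
  have e : ∫ x, ((k : ℝ) - ‖x‖ ^ 2) ∂μ = k * p - Q := by
    rw [integral_sub (integrable_const _) hint, ← hp', ← integral_const_mul, mul_one]
  rw [e]
  have key : ∀ t : ℝ, 1 < t → k * p / t - (t + 1) / 2 * Q ≤ Real.exp 2 * (t * R + 1) * R + 1 := by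
    intro t ht
    have h1 := stdGaussian_dilation_polyhedron_le u r hu ht.le hR
    have ht0 : 0 < t := by linarith
    rw [stdGaussian_preimage_smul (measurableSet_polyhedron u r) ht0] at h1
    -- The density ratio of the dilation is `exp (k * log t - (t ^ 2 - 1) * ‖x‖ ^ 2 / 2)`. Using `1
    -- + y ≤ exp y` and `1 - 1 / t ≤ log t` gives a lower bound, so no differentiation under the
    -- integral is needed.
    have hlow : ∫ x, (1 + k * ((t - 1) / t) - (t ^ 2 - 1) / 2 * ‖x‖ ^ 2) ∂μ ≤
        ∫ x, t ^ k * Real.exp (-(t ^ 2 - 1) * ‖x‖ ^ 2 / 2) ∂μ := by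
      refine integral_mono ((integrable_const _).sub (hint.const_mul _)) ?_ fun x => ?_
      · refine Integrable.of_bound (C := t ^ k) (by fun_prop)
          (Filter.Eventually.of_forall fun x => ?_)
        rw [Real.norm_eq_abs, abs_of_nonneg (by positivity)]
        refine mul_le_of_le_one_right (by positivity) (Real.exp_le_one_iff.2 ?_)
        have : 0 ≤ (t ^ 2 - 1) * ‖x‖ ^ 2 := mul_nonneg (by nlinarith) (by positivity)
        linarith
      · have h2 : t ^ k = Real.exp (k * Real.log t) := by
          rw [mul_comm, Real.exp_mul, Real.exp_log ht0, Real.rpow_natCast]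
        have h3 : (t - 1) / t ≤ Real.log t := by
          have := Real.one_sub_inv_le_log_of_pos ht0
          rwa [sub_div, div_self ht0.ne', one_div]
        have h4 : (k : ℝ) * ((t - 1) / t) ≤ k * Real.log t := by gcongr
        simp only
        rw [h2, ← Real.exp_add]
        refine le_trans ?_ (Real.add_one_le_exp _)
        linarith
    have hval : ∫ x, (1 + k * ((t - 1) / t) - (t ^ 2 - 1) / 2 * ‖x‖ ^ 2) ∂μ =
        (1 + k * ((t - 1) / t)) * p - (t ^ 2 - 1) / 2 * Q := by
      rw [integral_sub (integrable_const _) (hint.const_mul _), integral_const_mul,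
        integral_const, smul_eq_mul, mul_comm]
      simp [hμ, hp, hQ, measureReal_def]
    have h5 := (hval ▸ hlow).trans h1
    have h6 : (t - 1) * (k * p / t - (t + 1) / 2 * Q) ≤
        (t - 1) * (Real.exp 2 * (t * R + 1) * R + 1) := by
      have : (t - 1) * (k * p / t - (t + 1) / 2 * Q) =
        (1 + k * ((t - 1) / t)) * p - (t ^ 2 - 1) / 2 * Q - p := by ring
      linarith
    exact le_of_mul_le_mul_left h6 (by linarith)
  -- After division by `t - 1`, both sides of `key` are continuous at `1`; let `t` decrease to `1`.
  have hlim1 : Filter.Tendsto (fun t : ℝ => k * p / t - (t + 1) / 2 * Q)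
      (nhdsWithin 1 (Set.Ioi 1)) (nhds (k * p / 1 - (1 + 1) / 2 * Q)) := by
    refine (ContinuousAt.tendsto ?_).mono_left nhdsWithin_le_nhds
    fun_prop (disch := norm_num)
  have hlim2 : Filter.Tendsto (fun t : ℝ => Real.exp 2 * (t * R + 1) * R + 1)
      (nhdsWithin 1 (Set.Ioi 1)) (nhds (Real.exp 2 * (1 * R + 1) * R + 1)) := by
    refine (ContinuousAt.tendsto ?_).mono_left nhdsWithin_le_nhds
    fun_prop
  have := le_of_tendsto_of_tendsto hlim1 hlim2
    (Filter.eventually_of_mem self_mem_nhdsWithin fun t ht => key t ht)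
  norm_num at this
  linarith

end SecondMoment

/-! ### Moments of `k - ‖x‖²`. -/

section Moments

/-- Induction on `s`: when a summand is added, every mixed term containing a first power vanishes,
and the remaining cross term `6 * E[S²] * E[X²]` is absorbed by the growth of `3 * (card * v) ^ 2`.
-/
lemma fourth_moment_sum_of_iIndepFun {Ω ι : Type*} [MeasurableSpace Ω] {μ : Measure Ω}
    [IsProbabilityMeasure μ] {X : ι → Ω → ℝ} (hX : iIndepFun X μ) (hm : ∀ i, Measurable (X i))
    (hLp : ∀ i, MemLp (X i) 4 μ) {v M : ℝ} (h1 : ∀ i, ∫ ω, X i ω ∂μ = 0)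
    (h2 : ∀ i, ∫ ω, X i ω ^ 2 ∂μ = v) (h4 : ∀ i, ∫ ω, X i ω ^ 4 ∂μ ≤ M) (s : Finset ι) :
    MemLp (fun ω => ∑ i ∈ s, X i ω) 4 μ ∧ ∫ ω, ∑ i ∈ s, X i ω ∂μ = 0 ∧
      ∫ ω, (∑ i ∈ s, X i ω) ^ 2 ∂μ = s.card * v ∧
      ∫ ω, (∑ i ∈ s, X i ω) ^ 4 ∂μ ≤ 3 * (s.card * v) ^ 2 + s.card * M := by
  classical
  have hpow : ∀ {f : Ω → ℝ}, MemLp f 4 μ → ∀ j : ℕ, j ≤ 4 → Integrable (fun ω => f ω ^ j) μ := by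
    intro f hf j hj
    have hfj : MemLp f j μ := hf.mono_exponent (by exact_mod_cast hj)
    refine (integrable_norm_iff (by exact hf.1.pow j)).1 ?_
    simpa [norm_pow] using hfj.integrable_norm_pow' (p := j)
  induction s using Finset.induction_on with
  | empty => simp
  | insert a s ha ih =>
    obtain ⟨ihL, ih1, ih2, ih4⟩ := ih
    set S : Ω → ℝ := fun ω => ∑ i ∈ s, X i ω with hS
    have hSm : Measurable S := Finset.measurable_sum _ fun i _ => hm i
    have hind : IndepFun S (X a) μ := by
      have := hX.indepFun_finsetSum_of_notMem hm ha
      convert this using 1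
      ext ω
      simp [hS]
    have hip : ∀ p q : ℕ, IndepFun (fun ω => S ω ^ p) (fun ω => X a ω ^ q) μ := fun p q =>
      hind.comp (φ := fun x => x ^ p) (ψ := fun x => x ^ q) (by fun_prop) (by fun_prop)
    have hprod : ∀ p q : ℕ, ∫ ω, S ω ^ p * X a ω ^ q ∂μ =
        (∫ ω, S ω ^ p ∂μ) * ∫ ω, X a ω ^ q ∂μ := fun p q =>
      (hip p q).integral_fun_mul_eq_mul_integral (hSm.pow_const p).aestronglyMeasurable
        ((hm a).pow_const q).aestronglyMeasurable
    have hint : ∀ p q : ℕ, p ≤ 4 → q ≤ 4 → Integrable (fun ω => S ω ^ p * X a ω ^ q) μ :=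
      fun p q hp hq => (hip p q).integrable_mul (hpow ihL p hp) (hpow (hLp a) q hq)
    have hins : ∀ ω, ∑ i ∈ insert a s, X i ω = X a ω + S ω := fun ω => Finset.sum_insert ha
    simp only [hins, Finset.card_insert_of_notMem ha]
    have hXa1 : ∫ ω, X a ω ^ 1 ∂μ = 0 := by simpa using h1 a
    have hS1 : ∫ ω, S ω ^ 1 ∂μ = 0 := by simpa using ih1
    refine ⟨(hLp a).add ihL, ?_, ?_, ?_⟩
    · rw [integral_add ((hLp a).integrable (by norm_num)) (ihL.integrable (by norm_num)), h1 a, ih1,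
        add_zero]
    · have e : ∀ ω, (X a ω + S ω) ^ 2 = S ω ^ 2 + 2 * (S ω ^ 1 * X a ω ^ 1) + X a ω ^ 2 :=
        fun ω => by ring
      simp only [e]
      have i1 := hpow ihL 2 (by norm_num)
      have i2 := (hint 1 1 (by norm_num) (by norm_num)).const_mul 2
      rw [integral_add (i1.fun_add i2) (hpow (hLp a) 2 (by norm_num)),
        integral_add i1 i2, integral_const_mul, hprod, hXa1, h2 a, ih2]
      push_cast
      ring
    · have e : ∀ ω, (X a ω + S ω) ^ 4 = S ω ^ 4 + 4 * (S ω ^ 3 * X a ω ^ 1) +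
          6 * (S ω ^ 2 * X a ω ^ 2) + 4 * (S ω ^ 1 * X a ω ^ 3) + X a ω ^ 4 :=
        fun ω => by ring
      simp only [e]
      have i1 := hpow ihL 4 le_rfl
      have i2 := (hint 3 1 (by norm_num) (by norm_num)).const_mul 4
      have i3 := (hint 2 2 (by norm_num) (by norm_num)).const_mul 6
      have i4 := (hint 1 3 (by norm_num) (by norm_num)).const_mul 4
      rw [integral_add (((i1.fun_add i2).fun_add i3).fun_add i4) (hpow (hLp a) 4 le_rfl),
        integral_add ((i1.fun_add i2).fun_add i3) i4, integral_add (i1.fun_add i2) i3, integral_add i1 i2,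
        integral_const_mul, integral_const_mul, integral_const_mul, hprod, hprod, hprod, hXa1, hS1,
        h2 a, ih2]
      push_cast
      nlinarith [h4 a, sq_nonneg v]

/-- The first, second and fourth moments of `dim - ‖x‖²` under the standard Gaussian measure. -/
lemma exists_moments_card_sub_norm_sq : ∃ v M : ℝ, 0 < v ∧ 0 < M ∧
    ∀ (ι : Type) [Fintype ι],
      MemLp (fun x : EuclideanSpace ℝ ι => (Fintype.card ι : ℝ) - ‖x‖ ^ 2) 4
        (stdGaussian (EuclideanSpace ℝ ι)) ∧
      ∫ x : EuclideanSpace ℝ ι, ((Fintype.card ι : ℝ) - ‖x‖ ^ 2)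
        ∂(stdGaussian (EuclideanSpace ℝ ι)) = 0 ∧
      ∫ x : EuclideanSpace ℝ ι, ((Fintype.card ι : ℝ) - ‖x‖ ^ 2) ^ 2
        ∂(stdGaussian (EuclideanSpace ℝ ι)) = Fintype.card ι * v ∧
      ∫ x : EuclideanSpace ℝ ι, ((Fintype.card ι : ℝ) - ‖x‖ ^ 2) ^ 4
        ∂(stdGaussian (EuclideanSpace ℝ ι)) ≤
          3 * (Fintype.card ι * v) ^ 2 + Fintype.card ι * M := by
  let g : ℝ → ℝ := fun x => 1 - x ^ 2
  have hg : Measurable g := by fun_prop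
  have hgL : MemLp g 4 (gaussianReal 0 1) := by
    have h8 : MemLp (id : ℝ → ℝ) 8 (gaussianReal 0 1) := memLp_id_gaussianReal' 8 (by simp)
    have hsq : MemLp (fun x : ℝ => x * x) 4 (gaussianReal 0 1) := by
      have : ENNReal.HolderTriple 8 8 4 := ⟨by
        rw [← two_mul, show (8 : ENNReal) = 2 * 4 by norm_num,
          ENNReal.mul_inv (by simp) (by simp), ← mul_assoc,
          ENNReal.mul_inv_cancel (by simp) (by simp), one_mul]⟩
      exact h8.mul (p := 8) (q := 8) h8
    refine ((memLp_const (1 : ℝ)).sub hsq).congr_norm (by fun_prop) ?_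
    exact Filter.Eventually.of_forall fun x => by simp [g, sq]
  have hsq_int : Integrable (fun x : ℝ => x ^ 2) (gaussianReal 0 1) :=
    (memLp_id_gaussianReal' 2 (by simp)).integrable_sq
  have hg1 : ∫ x, g x ∂(gaussianReal 0 1) = 0 := by
    have hv := variance_fun_id_gaussianReal (μ := 0) (v := 1)
    rw [variance_of_integral_eq_zero (by fun_prop) (by simp)] at hv
    simp only [g]
    rw [integral_sub (integrable_const _) hsq_int, hv]
    simp
  have hg2i : Integrable (fun x => g x ^ 2) (gaussianReal 0 1) :=
    (hgL.mono_exponent (by norm_num)).integrable_sq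
  have hg2 : 0 < ∫ x, g x ^ 2 ∂(gaussianReal 0 1) := by
    refine lt_of_le_of_ne (integral_nonneg fun x => sq_nonneg _) fun h => ?_
    have h0 := (integral_eq_zero_iff_of_nonneg (fun x => sq_nonneg (g x)) hg2i).1 h.symm
    have h1 : ∀ᵐ x ∂(volume : Measure ℝ), g x ^ 2 = 0 :=
      (gaussianReal_absolutelyContinuous' 0 one_ne_zero).ae_le h0
    have h2 : (fun x => g x ^ 2) = fun _ => (0 : ℝ) :=
      (Continuous.ae_eq_iff_eq volume (by fun_prop) (by fun_prop)).1 h1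
    have := congrFun h2 0
    norm_num [g] at this
  -- The absolute value and the `+ 1` only serve to make `M` visibly positive.
  refine ⟨∫ x, g x ^ 2 ∂(gaussianReal 0 1), |∫ x, g x ^ 4 ∂(gaussianReal 0 1)| + 1, hg2,
    by positivity, fun ι _ => ?_⟩
  set P : Measure (ι → ℝ) := Measure.pi fun _ => gaussianReal 0 1 with hP
  have hmp : ∀ i, MeasurePreserving (fun x : ι → ℝ => x i) P (gaussianReal 0 1) := fun i =>
    measurePreserving_eval _ i
  have hind : iIndepFun (fun (i : ι) (x : ι → ℝ) => g (x i)) P :=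
    iIndepFun_pi fun _ => hg.aemeasurable
  have key := fourth_moment_sum_of_iIndepFun (v := ∫ x, g x ^ 2 ∂(gaussianReal 0 1))
    (M := |∫ x, g x ^ 4 ∂(gaussianReal 0 1)| + 1) hind (fun i => by fun_prop)
    (fun i => hgL.comp_measurePreserving (hmp i))
    (fun i => by rw [← hg1, ← (hmp i).map_eq, integral_map (measurable_pi_apply i).aemeasurable (by fun_prop)])
    (fun i => by rw [← (hmp i).map_eq, integral_map (measurable_pi_apply i).aemeasurable (by fun_prop)])
    (fun i => by
      have : ∫ x, g (x i) ^ 4 ∂P = ∫ x, g x ^ 4 ∂(gaussianReal 0 1) := by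
        rw [← (hmp i).map_eq, integral_map (measurable_pi_apply i).aemeasurable (by fun_prop)]
      rw [this]
      linarith [le_abs_self (∫ x, g x ^ 4 ∂(gaussianReal 0 1))]) Finset.univ
  have hsum : ∀ x : ι → ℝ, ∑ i, g (x i) = (Fintype.card ι : ℝ) - ‖(WithLp.toLp 2 x :
      EuclideanSpace ℝ ι)‖ ^ 2 := by
    intro x
    rw [EuclideanSpace.real_norm_sq_eq]
    simp [g, Finset.sum_sub_distrib]
  simp only [hsum, Finset.card_univ] at key
  rw [← map_pi_eq_stdGaussian, ← hP]
  rw [memLp_map_measure_iff (by fun_prop) (by fun_prop), integral_map (by fun_prop) (by fun_prop),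
    integral_map (by fun_prop) (by fun_prop), integral_map (by fun_prop) (by fun_prop)]
  exact key

end Moments

/-! ### Balls of radius about `√k` need exponentially many facets in `√k`. -/

section BallApproximation

lemma exists_normalized_polyhedron {E : Type*} [NormedAddCommGroup E] [InnerProductSpace ℝ E]
    {m : ℕ} (u : Fin m → E) (r : Fin m → ℝ) :
    ∃ (u' : Fin m → E) (r' : Fin m → ℝ), (∀ i, ‖u' i‖ = 1 ∨ u' i = 0) ∧
      polyhedron u' r' = polyhedron u r := by
  classical
  refine ⟨fun i => ‖u i‖⁻¹ • u i, fun i => if u i = 0 then r i else ‖u i‖⁻¹ * r i, fun i => ?_, ?_⟩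
  · by_cases h : u i = 0
    · exact Or.inr (by simp [h])
    · exact Or.inl (by simp [norm_smul, h])
  · ext x
    simp only [polyhedron, Set.mem_ofPred_eq]
    refine forall_congr' fun i => ?_
    by_cases h : u i = 0
    · simp [h]
    · have : 0 < ‖u i‖⁻¹ := by positivity
      rw [if_neg h, inner_smul_left]
      exact mul_le_mul_iff_right₀ this

/-- The positive part of `dim - ‖x‖²` has expectation of order at least `√dim`. -/
lemma exists_le_integral_pos_part : ∃ c : ℝ, 0 < c ∧ ∀ (ι : Type) [Fintype ι] [Nonempty ι],
    c * √(Fintype.card ι) ≤ ∫ x : EuclideanSpace ℝ ι, max ((Fintype.card ι : ℝ) - ‖x‖ ^ 2) 0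
      ∂(stdGaussian (EuclideanSpace ℝ ι)) := by
  obtain ⟨v, M, hv, hM, h⟩ := exists_moments_card_sub_norm_sq
  set B : ℝ := 3 * v ^ 2 + M with hB
  have hB0 : 0 < B := by positivity
  -- Chosen so that, with the threshold `A = q * √k` below, the fourth-moment term is exactly half
  -- of the second moment `k * v`.
  set q : ℝ := √(2 * B / v) with hq
  have hq0 : 0 < q := by positivity
  have hq2 : q ^ 2 = 2 * B / v := Real.sq_sqrt (by positivity)
  refine ⟨v / (4 * q), by positivity, fun ι _ _ => ?_⟩
  obtain ⟨hL, h1, h2, h4⟩ := h ι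
  set k : ℝ := (Fintype.card ι : ℝ) with hk
  have hk1 : 1 ≤ k := by
    have : 0 < Fintype.card ι := Fintype.card_pos
    rw [hk]; exact_mod_cast this
  set s : ℝ := √k with hs
  have hs0 : 0 < s := by positivity
  have hs2 : s ^ 2 = k := Real.sq_sqrt (by linarith)
  set γ := stdGaussian (EuclideanSpace ℝ ι) with hγ
  let T : EuclideanSpace ℝ ι → ℝ := fun x => k - ‖x‖ ^ 2
  have hT1 : Integrable T γ := hL.integrable (by norm_num)
  have hT2 : Integrable (fun x => T x ^ 2) γ := (hL.mono_exponent (by norm_num)).integrable_sq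
  have hT4 : Integrable (fun x => T x ^ 4) γ := by
    have := hL.integrable_norm_pow (p := 4) (by norm_num)
    refine this.congr (Filter.Eventually.of_forall fun x => ?_)
    simp only [Real.norm_eq_abs]
    exact Even.pow_abs (by decide) _
  have hpos : Integrable (fun x => max (T x) 0) γ := hT1.pos_part
  set A : ℝ := q * s with hA
  have hA0 : 0 < A := by positivity
  -- The first term suffices where `|T| ≤ A` and the second where `|T| ≥ A`. Here `|T| = 2 * max T 0
  -- - T`, and `T` has mean zero.
  have hpt : ∀ x, T x ^ 2 ≤ A * (2 * max (T x) 0 - T x) + (A ^ 2)⁻¹ * T x ^ 4 := by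
    intro x
    have habs : 2 * max (T x) 0 - T x = |T x| := by
      rcases le_total (T x) 0 with h | h
      · rw [max_eq_right h, abs_of_nonpos h]; ring
      · rw [max_eq_left h, abs_of_nonneg h]; ring
    rw [habs]
    rcases le_total |T x| A with h | h
    · have e : T x ^ 2 = |T x| * |T x| := by rw [← sq, sq_abs]
      have : 0 ≤ (A ^ 2)⁻¹ * T x ^ 4 := by positivity
      rw [e]
      nlinarith [abs_nonneg (T x)]
    · have e : A ^ 2 ≤ T x ^ 2 := by rw [← sq_abs (T x)]; gcongr
      have : T x ^ 2 ≤ (A ^ 2)⁻¹ * T x ^ 4 := by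
        rw [le_inv_mul_iff₀ (by positivity)]
        nlinarith [sq_nonneg (T x)]
      have : 0 ≤ A * |T x| := by positivity
      linarith
  have hint := integral_mono hT2 (((hpos.const_mul 2).sub hT1).const_mul A |>.add
    (hT4.const_mul (A ^ 2)⁻¹)) hpt
  have e : ∫ x, ((fun x => A * ((fun x => 2 * max (T x) 0) - T) x) +
      fun x => (A ^ 2)⁻¹ * T x ^ 4) x ∂γ =
      A * (2 * ∫ x, max (T x) 0 ∂γ) + (A ^ 2)⁻¹ * ∫ x, T x ^ 4 ∂γ := by
    have h0 : ∫ x, T x ∂γ = 0 := h1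
    rw [integral_add' (((hpos.const_mul 2).sub hT1).const_mul A) (hT4.const_mul (A ^ 2)⁻¹),
      integral_const_mul, integral_const_mul, integral_sub' (hpos.const_mul 2) hT1,
      integral_const_mul, h0, sub_zero]
  have h2' : ∫ x, T x ^ 2 ∂γ = k * v := h2
  have h4' : ∫ x, T x ^ 4 ∂γ ≤ B * k ^ 2 := by
    refine h4.trans ?_
    rw [hB]
    nlinarith [mul_nonneg hM.le (by nlinarith : 0 ≤ k ^ 2 - k)]
  have hfin : k * v ≤ A * (2 * ∫ x, max (T x) 0 ∂γ) + (A ^ 2)⁻¹ * (B * k ^ 2) := by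
    rw [← h2']
    refine (hint.trans (le_of_eq e)).trans ?_
    gcongr
  have e2 : (A ^ 2)⁻¹ * (B * k ^ 2) = k * v / 2 := by
    rw [hA, mul_pow, hq2, hs2]
    field_simp
  rw [e2] at hfin
  change v / (4 * q) * s ≤ ∫ x, max (T x) 0 ∂γ
  rw [div_mul_eq_mul_div, div_le_iff₀ (by positivity)]
  have hfin' : s * (v * s) ≤ s * ((∫ x, max (T x) 0 ∂γ) * (4 * q)) := by
    have : k = s * s := by rw [← hs2]; ring
    rw [hA, this] at hfin
    linarith
  exact le_of_mul_le_mul_left hfin' hs0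

/-- An intersection of `m` halfspaces that approximates a ball of radius about `√k` in `ℝᵏ` up to
a small constant Gaussian distance has `m ≥ 2 ^ Ω(√k)`. -/
lemma exists_ball_approximation_bound : ∃ c η : ℝ, 0 < c ∧ 0 < η ∧
    ∀ (ι : Type) [Fintype ι] [Nonempty ι] (ρ : ℝ),
      (Fintype.card ι : ℝ) - c * √(Fintype.card ι) ≤ ρ ^ 2 → ρ ^ 2 ≤ Fintype.card ι → 0 ≤ ρ →
      ∀ (m : ℕ) (u : Fin m → EuclideanSpace ℝ ι) (r : Fin m → ℝ),
        (stdGaussian (EuclideanSpace ℝ ι)).real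
          (symmDiff {x | ‖x‖ ≤ ρ} (polyhedron u r)) ≤ η →
        c * √(Fintype.card ι) ≤
          Real.exp 2 * (2 * √(Real.log m) + 1) * (2 * √(Real.log m)) + 1 := by
  obtain ⟨v, M, hv, -, hmom⟩ := exists_moments_card_sub_norm_sq
  obtain ⟨c₀, hc₀, hpos⟩ := exists_le_integral_pos_part
  set c : ℝ := c₀ / 4 with hc
  have hc0 : 0 < c := by positivity
  -- The positive part has mean at least `4 * c * √k`. Three errors of `c * √k` each will be
  -- subtracted: the radius defect, and the two terms of Young's inequality on the symmetric
  -- difference.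
  refine ⟨c, 4 * c ^ 2 / v, hc0, by positivity, fun ι _ _ ρ hρ1 hρ2 hρ0 m u r hη => ?_⟩
  obtain ⟨u', r', hu', hP⟩ := exists_normalized_polyhedron u r
  have hbound := integral_polyhedron_finrank_sub_norm_sq_le u' r' hu' (R := 2 * √(Real.log m)) rfl
  rw [hP, finrank_euclideanSpace] at hbound
  refine le_trans ?_ hbound
  obtain ⟨hL, h1, h2, -⟩ := hmom ι
  replace hpos := hpos ι
  set k : ℝ := (Fintype.card ι : ℝ) with hk
  have hk1 : 1 ≤ k := by
    have : 0 < Fintype.card ι := Fintype.card_pos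
    rw [hk]; exact_mod_cast this
  set s : ℝ := √k with hs
  have hs0 : 0 < s := by positivity
  have hs2 : s ^ 2 = k := Real.sq_sqrt (by linarith)
  set γ := stdGaussian (EuclideanSpace ℝ ι) with hγ
  let T : EuclideanSpace ℝ ι → ℝ := fun x => k - ‖x‖ ^ 2
  have hT1 : Integrable T γ := hL.integrable (by norm_num)
  have hT2 : Integrable (fun x => T x ^ 2) γ := (hL.mono_exponent (by norm_num)).integrable_sq
  have hpos_int : Integrable (fun x => max (T x) 0) γ := hT1.pos_part
  set L := polyhedron u r with hLdef
  set D := symmDiff {x : EuclideanSpace ℝ ι | ‖x‖ ≤ ρ} L with hD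
  have hLm : MeasurableSet L := measurableSet_polyhedron u r
  have hDm : MeasurableSet D :=
    (measurableSet_le (by fun_prop) (by fun_prop)).symmDiff hLm
  set A : ℝ := v * s / (2 * c) with hA
  have hA0 : 0 < A := by positivity
  -- Off `D`, the set `L` agrees with the ball, where `T ≥ 0`; outside the ball the positive part is
  -- at most `c * s`. On `D` the error `|T|` is paid for by Young's inequality, and `A` balances its
  -- two terms after integration.
  have hpt : ∀ x, max (T x) 0 - c * s - ((2 * A)⁻¹ * T x ^ 2 + A / 2 * D.indicator 1 x) ≤
      L.indicator T x := by
    intro x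
    have hyoung : |T x| ≤ (2 * A)⁻¹ * T x ^ 2 + A / 2 := by
      rw [← sq_abs]
      have : 0 ≤ (2 * A)⁻¹ * (|T x| - A) ^ 2 := by positivity
      have e : (2 * A)⁻¹ * (|T x| - A) ^ 2 = (2 * A)⁻¹ * |T x| ^ 2 + A / 2 - |T x| := by
        field_simp
        ring
      linarith
    have hsqnn : 0 ≤ (2 * A)⁻¹ * T x ^ 2 := by positivity
    have hcs : 0 < c * s := by positivity
    have hTle : max (T x) 0 ≤ |T x| := max_le (le_abs_self _) (abs_nonneg _)
    have hTge : -|T x| ≤ T x := neg_abs_le _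
    by_cases hB : ‖x‖ ≤ ρ
    · have hT0 : 0 ≤ T x := by
        have : ‖x‖ ^ 2 ≤ ρ ^ 2 := by gcongr
        simp only [T]; linarith
      by_cases hxL : x ∈ L
      · have hxD : x ∉ D := by simp [hD, Set.mem_symmDiff, hB, hxL]
        rw [Set.indicator_of_mem hxL, Set.indicator_of_notMem hxD, max_eq_left hT0]
        linarith
      · have hxD : x ∈ D := by simp [hD, Set.mem_symmDiff, hB, hxL]
        rw [Set.indicator_of_notMem hxL, Set.indicator_of_mem hxD, Pi.one_apply]
        linarith
    · have hTs : max (T x) 0 ≤ c * s := by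
        have : ρ ^ 2 ≤ ‖x‖ ^ 2 := by
          gcongr
          exact (not_le.1 hB).le
        refine max_le ?_ hcs.le
        simp only [T]; linarith
      by_cases hxL : x ∈ L
      · have hxD : x ∈ D := by simp [hD, Set.mem_symmDiff, hB, hxL]
        rw [Set.indicator_of_mem hxL, Set.indicator_of_mem hxD, Pi.one_apply]
        linarith
      · have hxD : x ∉ D := by simp [hD, Set.mem_symmDiff, hB, hxL]
        rw [Set.indicator_of_notMem hxL, Set.indicator_of_notMem hxD]
        linarith
  have hDi : Integrable (D.indicator (1 : EuclideanSpace ℝ ι → ℝ)) γ :=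
    (integrable_const (1 : ℝ)).indicator hDm
  have i1 : Integrable (fun x => max (T x) 0 - c * s) γ := hpos_int.sub (integrable_const (c * s))
  have i2 : Integrable (fun x => (2 * A)⁻¹ * T x ^ 2 +
      A / 2 * D.indicator (1 : EuclideanSpace ℝ ι → ℝ) x) γ :=
    (hT2.const_mul (2 * A)⁻¹).add (hDi.const_mul (A / 2))
  have hint := integral_mono (i1.sub i2) (hT1.indicator hLm) hpt
  rw [integral_sub' i1 i2,
    integral_sub hpos_int (integrable_const (c * s)),
    integral_add (hT2.const_mul (2 * A)⁻¹) (hDi.const_mul (A / 2)),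
    integral_const_mul (2 * A)⁻¹, integral_const_mul (A / 2), integral_indicator hLm, integral_indicator_one hDm, integral_const,
    probReal_univ, one_smul] at hint
  have h2' : ∫ x, T x ^ 2 ∂γ = k * v := h2
  rw [h2'] at hint
  refine le_trans ?_ hint
  have e1 : (2 * A)⁻¹ * (k * v) = c * s := by
    rw [hA, ← hs2]; field_simp
  have e2 : A / 2 * γ.real D ≤ c * s := by
    calc A / 2 * γ.real D ≤ A / 2 * (4 * c ^ 2 / v) := by gcongr
      _ = c * s := by rw [hA]; field_simp; ring
  have e3 : 4 * (c * s) ≤ ∫ x, max (T x) 0 ∂γ := by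
    refine le_trans (le_of_eq ?_) hpos
    rw [hc]; ring
  linarith

end BallApproximation

/-! ### The truncated cone as a convex body of geometric width one. -/

section TruncatedCone

variable {n : ℕ}

/-- The Euclidean norm of the coordinates of `x` in the block `P`. -/
noncomputable def blockNorm (P : Finset (Fin n)) (x : EuclideanSpace ℝ (Fin n)) : ℝ :=
  √(∑ i ∈ P, x i ^ 2)

lemma continuous_blockNorm (P : Finset (Fin n)) : Continuous (blockNorm P) := by
  unfold blockNorm; fun_prop

lemma sq_blockNorm (P : Finset (Fin n)) (x : EuclideanSpace ℝ (Fin n)) :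
    blockNorm P x ^ 2 = ∑ i ∈ P, x i ^ 2 :=
  Real.sq_sqrt (Finset.sum_nonneg fun _ _ => sq_nonneg _)

lemma blockNorm_nonneg (P : Finset (Fin n)) (x : EuclideanSpace ℝ (Fin n)) :
    0 ≤ blockNorm P x := Real.sqrt_nonneg _

/-- The unit vectors with coordinate `a` at `i₀`, the remaining support being in the block `P`. -/
def coneNormals (i₀ : Fin n) (P : Finset (Fin n)) (a : ℝ) : Set (EuclideanSpace ℝ (Fin n)) :=
  {u | ‖u‖ = 1 ∧ u i₀ = a ∧ ∀ i, i ≠ i₀ → i ∉ P → u i = 0}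

lemma sum_univ_eq_of_support {i₀ : Fin n} {P : Finset (Fin n)} (h0 : i₀ ∉ P) (f : Fin n → ℝ)
    (hf : ∀ i, i ≠ i₀ → i ∉ P → f i = 0) : ∑ i, f i = f i₀ + ∑ i ∈ P, f i := by
  rw [← Finset.sum_insert h0]
  refine (Finset.sum_subset (Finset.subset_univ _) fun i _ hi => ?_).symm
  rw [Finset.mem_insert, not_or] at hi
  exact hf i hi.1 hi.2

/-- The equality case of Cauchy–Schwarz. If `x` vanishes on the block, any unit vector there works,
which is why `P` must be nonempty. -/
lemma exists_unit_sum_mul_eq (P : Finset (Fin n)) (hP : P.Nonempty)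
    (x : EuclideanSpace ℝ (Fin n)) :
    ∃ v : Fin n → ℝ, ∑ i ∈ P, v i ^ 2 = 1 ∧ ∑ i ∈ P, v i * x i = blockNorm P x := by
  classical
  by_cases h : blockNorm P x = 0
  · obtain ⟨j, hj⟩ := hP
    have hx : x j = 0 := by
      have h2 := sq_blockNorm P x
      rw [h] at h2
      have := (Finset.sum_eq_zero_iff_of_nonneg fun i _ => sq_nonneg (x i)).1
        (h2.symm.trans (by norm_num)) j hj
      exact pow_eq_zero_iff (two_ne_zero) |>.1 this
    exact ⟨fun i => if i = j then 1 else 0, by simp [hj], by simp [hj, hx, h]⟩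
  · refine ⟨fun i => x i / blockNorm P x, ?_, ?_⟩
    · simp only [div_pow]
      rw [← Finset.sum_div, ← sq_blockNorm]
      field_simp
    · have : ∀ i, x i / blockNorm P x * x i = x i ^ 2 / blockNorm P x := fun i => by ring
      simp only [this]
      rw [← Finset.sum_div, ← sq_blockNorm]
      field_simp

/-- The halfspaces with normals in `coneNormals` at distance `1` cut out a circular cone. -/
lemma forall_coneNormals_inner_le_iff {i₀ : Fin n} {P : Finset (Fin n)} (h0 : i₀ ∉ P)
    (hP : P.Nonempty) {a b : ℝ} (hb : 0 ≤ b) (hab : a ^ 2 + b ^ 2 = 1)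
    (x : EuclideanSpace ℝ (Fin n)) :
    (∀ u ∈ coneNormals i₀ P a, inner ℝ u x ≤ 1) ↔ a * x i₀ + b * blockNorm P x ≤ 1 := by
  have hinner : ∀ u : EuclideanSpace ℝ (Fin n), (∀ i, i ≠ i₀ → i ∉ P → u i = 0) →
      inner ℝ u x = u i₀ * x i₀ + ∑ i ∈ P, u i * x i := by
    intro u hu
    rw [PiLp.inner_apply, ← sum_univ_eq_of_support h0 (fun i => u i * x i)
      fun i h1 h2 => by simp [hu i h1 h2]]
    simp [mul_comm]
  have hnorm : ∀ u : EuclideanSpace ℝ (Fin n), (∀ i, i ≠ i₀ → i ∉ P → u i = 0) →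
      ‖u‖ ^ 2 = u i₀ ^ 2 + ∑ i ∈ P, u i ^ 2 := by
    intro u hu
    rw [EuclideanSpace.real_norm_sq_eq, ← sum_univ_eq_of_support h0 (fun i => u i ^ 2)
      fun i h1 h2 => by simp [hu i h1 h2]]
  constructor
  · intro h
    obtain ⟨v, hv1, hv2⟩ := exists_unit_sum_mul_eq P hP x
    classical
    let u : EuclideanSpace ℝ (Fin n) :=
      WithLp.toLp 2 fun i => if i = i₀ then a else if i ∈ P then b * v i else 0
    have hu0 : u i₀ = a := by simp [u]
    have huP : ∀ i ∈ P, u i = b * v i := by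
      intro i hi
      have : i ≠ i₀ := fun h => h0 (h ▸ hi)
      simp [u, this, hi]
    have hus : ∀ i, i ≠ i₀ → i ∉ P → u i = 0 := by
      intro i h1 h2
      simp [u, h1, h2]
    have hun : ‖u‖ = 1 := by
      have h2 : ‖u‖ ^ 2 = 1 := by
        rw [hnorm u hus, hu0, Finset.sum_congr rfl fun i hi => by rw [huP i hi, mul_pow],
          ← Finset.mul_sum, hv1, mul_one, hab]
      exact (pow_eq_one_iff_of_nonneg (norm_nonneg _) two_ne_zero).1 h2
    have := h u ⟨hun, hu0, hus⟩
    rwa [hinner u hus, hu0, Finset.sum_congr rfl fun i hi => by rw [huP i hi, mul_assoc],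
      ← Finset.mul_sum, hv2] at this
  · rintro h u ⟨hun, hu0, hus⟩
    rw [hinner u hus, hu0]
    have hcs := Real.sum_mul_le_sqrt_mul_sqrt P (fun i => u i) (fun i => x i)
    have h2 := hnorm u hus
    rw [hun, hu0] at h2
    have h3 : √(∑ i ∈ P, u i ^ 2) = b := by
      rw [show ∑ i ∈ P, u i ^ 2 = b ^ 2 by linarith, Real.sqrt_sq hb]
    rw [h3] at hcs
    change _ ≤ b * blockNorm P x at hcs
    linarith

/-- A body whose slices with fixed coordinates outside of the block `P` are Euclidean balls. -/
def truncatedCone (i₀ : Fin n) (P Q : Finset (Fin n)) (a b a' b' : ℝ) :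
    Set (EuclideanSpace ℝ (Fin n)) :=
  {x | -x i₀ ≤ 1 ∧ a * x i₀ + b * blockNorm P x ≤ 1 ∧ a' * x i₀ + b' * blockNorm Q x ≤ 1}

variable {i₀ : Fin n} {P Q : Finset (Fin n)} {a b a' b' : ℝ}

lemma truncatedCone_eq_iInter (h0P : i₀ ∉ P) (h0Q : i₀ ∉ Q) (hP : P.Nonempty) (hQ : Q.Nonempty)
    (hb : 0 ≤ b) (hab : a ^ 2 + b ^ 2 = 1) (hb' : 0 ≤ b') (hab' : a' ^ 2 + b' ^ 2 = 1) :
    ∃ U : Set (EuclideanSpace ℝ (Fin n)), (∀ u ∈ U, ‖u‖ = 1) ∧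
      truncatedCone i₀ P Q a b a' b' = ⋂ u ∈ U, halfspace u 1 := by
  refine ⟨{-EuclideanSpace.single i₀ 1} ∪ (coneNormals i₀ P a ∪ coneNormals i₀ Q a'), ?_, ?_⟩
  · rintro u (hu | hu | hu)
    · rw [Set.mem_singleton_iff.1 hu]; simp
    · exact hu.1
    · exact hu.1
  · ext x
    simp only [truncatedCone, Set.mem_ofPred_eq, Set.mem_iInter, halfspace, Set.mem_union,
      or_imp, forall_and, Set.mem_singleton_iff, forall_eq,
      forall_coneNormals_inner_le_iff h0P hP hb hab, forall_coneNormals_inner_le_iff h0Q hQ hb' hab']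
    simp [EuclideanSpace.inner_single_left]

lemma closedBall_subset_iInter_halfspace {U : Set (EuclideanSpace ℝ (Fin n))}
    (hU : ∀ u ∈ U, ‖u‖ = 1) : Metric.closedBall 0 1 ⊆ ⋂ u ∈ U, halfspace u 1 := by
  intro x hx
  simp only [Set.mem_iInter, halfspace, Set.mem_ofPred_eq]
  intro u hu
  refine (real_inner_le_norm u x).trans ?_
  rw [hU u hu, one_mul]
  simpa using hx

/-- The intersection contains the unit ball, so any halfspace with unit normal `u` that contains it
contains `u` itself and has offset at least `1`. Properness of the set guarantees that a competing
family has a member to test. -/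
lemma hasGeometricWidth_one_iInter_halfspace {U : Set (EuclideanSpace ℝ (Fin n))}
    (hU : ∀ u ∈ U, ‖u‖ = 1) (hne : (⋂ u ∈ U, halfspace u 1) ≠ Set.univ) :
    HasGeometricWidth (⋂ u ∈ U, halfspace u 1) 1 := by
  constructor
  · refine ⟨{p | p.1 ∈ U ∧ p.2 = 1}, fun p hp => ⟨hU _ hp.1, hp.2.le⟩, ?_⟩
    ext x
    simp only [Set.mem_iInter, Set.mem_ofPred_eq, Prod.forall]
    exact ⟨fun h u r hr => by rw [hr.2]; exact h u hr.1, fun h u hu => h u 1 ⟨hu, rfl⟩⟩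
  · rintro s ⟨T, hT, hK⟩
    have hTne : T.Nonempty := by
      by_contra hcon
      rw [Set.not_nonempty_iff_eq_empty] at hcon
      rw [hcon] at hK
      exact hne (by rw [hK]; simp)
    obtain ⟨p, hp⟩ := hTne
    have hball : p.1 ∈ Metric.closedBall (0 : EuclideanSpace ℝ (Fin n)) 1 := by
      simp [(hT p hp).1]
    have hmem := closedBall_subset_iInter_halfspace hU hball
    rw [hK] at hmem
    have h1 : inner ℝ p.1 p.1 ≤ p.2 := Set.mem_iInter₂.1 hmem p hp
    rw [real_inner_self_eq_norm_sq, (hT p hp).1] at h1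
    have := (hT p hp).2
    linarith

lemma isClosed_truncatedCone : IsClosed (truncatedCone i₀ P Q a b a' b') := by
  have hP := continuous_blockNorm P
  have hQ := continuous_blockNorm Q
  simp only [truncatedCone, Set.ofPred_and]
  exact (isClosed_le (by fun_prop) (by fun_prop)).inter
    ((isClosed_le (by fun_prop) (by fun_prop)).inter (isClosed_le (by fun_prop) (by fun_prop)))

/-- The cap `-x i₀ ≤ 1` bounds `x i₀` below, either cone bounds it above, and then each cone bounds
its own block; together these are all coordinates. -/
lemma isBounded_truncatedCone (hcover : ∀ i, i = i₀ ∨ i ∈ P ∨ i ∈ Q) (ha : 0 < a) (hb : 0 < b)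
    (ha' : 0 < a') (hb' : 0 < b') : Bornology.IsBounded (truncatedCone i₀ P Q a b a' b') := by
  rw [isBounded_iff_forall_norm_le]
  refine ⟨√((1 + 1 / a) ^ 2 + ((1 + a) / b) ^ 2 + ((1 + a') / b') ^ 2), ?_⟩
  rintro x ⟨h1, h2, h3⟩
  have hNP := blockNorm_nonneg P x
  have hNQ := blockNorm_nonneg Q x
  have hx0 : x i₀ ≤ 1 / a := by
    rw [le_div_iff₀ ha]
    nlinarith [mul_nonneg hb.le hNP]
  have hP : blockNorm P x ≤ (1 + a) / b := by
    rw [le_div_iff₀ hb]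
    nlinarith
  have hQ : blockNorm Q x ≤ (1 + a') / b' := by
    rw [le_div_iff₀ hb']
    nlinarith
  have h1a : 0 < 1 / a := by positivity
  apply Real.le_sqrt_of_sq_le
  have hle : ‖x‖ ^ 2 ≤ x i₀ ^ 2 + blockNorm P x ^ 2 + blockNorm Q x ^ 2 := by
    rw [EuclideanSpace.real_norm_sq_eq, sq_blockNorm, sq_blockNorm]
    classical
    have hu : (Finset.univ : Finset (Fin n)) ⊆ {i₀} ∪ P ∪ Q := by
      intro i _
      simpa [or_assoc] using hcover i
    have hnn : ∀ s : Finset (Fin n), 0 ≤ ∑ i ∈ s, x i ^ 2 := fun s =>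
      Finset.sum_nonneg fun i _ => sq_nonneg _
    have hunion : ∀ s t : Finset (Fin n), ∑ i ∈ s ∪ t, x i ^ 2 ≤ ∑ i ∈ s, x i ^ 2 +
        ∑ i ∈ t, x i ^ 2 := fun s t => by
      have := Finset.sum_union_inter (s₁ := s) (s₂ := t) (f := fun i => x i ^ 2)
      linarith [hnn (s ∩ t)]
    calc ∑ i, x i ^ 2 ≤ ∑ i ∈ {i₀} ∪ P ∪ Q, x i ^ 2 :=
          Finset.sum_le_sum_of_subset_of_nonneg hu fun i _ _ => sq_nonneg _
      _ ≤ ∑ i ∈ {i₀} ∪ P, x i ^ 2 + ∑ i ∈ Q, x i ^ 2 := hunion _ _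
      _ ≤ (∑ i ∈ {i₀}, x i ^ 2 + ∑ i ∈ P, x i ^ 2) + ∑ i ∈ Q, x i ^ 2 := by
          gcongr; exact hunion _ _
      _ = _ := by simp
  have e1 : x i₀ ^ 2 ≤ (1 + 1 / a) ^ 2 := by
    rw [sq_le_sq, abs_of_pos (by positivity : 0 < 1 + 1 / a), abs_le]
    constructor <;> linarith
  have e2 : blockNorm P x ^ 2 ≤ ((1 + a) / b) ^ 2 := by gcongr
  have e3 : blockNorm Q x ^ 2 ≤ ((1 + a') / b') ^ 2 := by gcongr
  linarith

lemma truncatedCone_isConvexBody_and_hasGeometricWidth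
    (hcover : ∀ i, i = i₀ ∨ i ∈ P ∨ i ∈ Q) (h0P : i₀ ∉ P) (h0Q : i₀ ∉ Q)
    (hP : P.Nonempty) (hQ : Q.Nonempty) (ha : 0 < a) (hb : 0 < b) (hab : a ^ 2 + b ^ 2 = 1)
    (ha' : 0 < a') (hb' : 0 < b') (hab' : a' ^ 2 + b' ^ 2 = 1) :
    IsConvexBody (truncatedCone i₀ P Q a b a' b') ∧
      HasGeometricWidth (truncatedCone i₀ P Q a b a' b') 1 := by
  obtain ⟨U, hU, hK⟩ := truncatedCone_eq_iInter h0P h0Q hP hQ hb.le hab hb'.le hab'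
  refine ⟨⟨?_, Metric.isCompact_of_isClosed_isBounded isClosed_truncatedCone
    (isBounded_truncatedCone hcover ha hb ha' hb'), 0, ?_⟩, ?_⟩
  · rw [hK]
    refine convex_iInter₂ fun u _ => ?_
    exact convex_halfSpace_le (innerₗ (EuclideanSpace ℝ (Fin n)) u).isLinear 1
  · refine interior_mono (hK ▸ closedBall_subset_iInter_halfspace hU) ?_
    exact Metric.ball_subset_interior_closedBall (Metric.mem_ball_self one_pos)
  · rw [hK]
    refine hasGeometricWidth_one_iInter_halfspace hU fun h => ?_
    have : EuclideanSpace.single i₀ (-2 : ℝ) ∈ truncatedCone i₀ P Q a b a' b' := by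
      rw [hK, h]; trivial
    have h1 := this.1
    norm_num at h1

end TruncatedCone

/-! ### Fubini over a block of coordinates. -/

section Slicing

/-- The vector obtained from `x` by replacing the coordinates in `P` by those of `y`. -/
def replaceBlock {n : ℕ} (P : Finset (Fin n)) (x : Fin n → ℝ) (y : {i // i ∈ P} → ℝ) : Fin n → ℝ :=
  fun i => if h : i ∈ P then y ⟨i, h⟩ else x i

/-- `G` need not be a cylinder over the coordinates outside `P`: a single point of `G` in a fibre
already bounds the fibre of `S` below by `η`, and the fibre of `G` has measure at most one. -/
lemma mul_pi_le_pi_of_slices {n : ℕ} (P : Finset (Fin n)) {S G : Set (Fin n → ℝ)}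
    (hS : MeasurableSet S) (hG : MeasurableSet G) (η : ENNReal)
    (h : ∀ x ∈ G, η ≤ Measure.pi (fun _ : {i // i ∈ P} => gaussianReal 0 1)
      {y | replaceBlock P x y ∈ S}) :
    η * Measure.pi (fun _ : Fin n => gaussianReal 0 1) G ≤
      Measure.pi (fun _ : Fin n => gaussianReal 0 1) S := by
  have hmp := (measurePreserving_piEquivPiSubtypeProd (fun _ : Fin n => gaussianReal 0 1)
    (fun i => i ∈ P)).symm
  rw [← hmp.measure_preimage hS.nullMeasurableSet, ← hmp.measure_preimage hG.nullMeasurableSet,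
    Measure.prod_apply_symm (hmp.measurable hS), Measure.prod_apply_symm (hmp.measurable hG),
    ← lintegral_const_mul _ (measurable_measure_prodMk_right (hmp.measurable hG))]
  refine lintegral_mono fun w => ?_
  set e := MeasurableEquiv.piEquivPiSubtypeProd (fun _ : Fin n => ℝ) (fun i => i ∈ P) with he
  have happ : ∀ y, e.symm (y, w) = fun i => if h : i ∈ P then y ⟨i, h⟩ else w ⟨i, h⟩ :=
    fun y => rfl
  rcases Set.eq_empty_or_nonempty ((fun y => (y, w)) ⁻¹' (e.symm ⁻¹' G)) with hempty | ⟨y₀, hy₀⟩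
  · rw [hempty]; simp
  · have hrep : ∀ y, replaceBlock P (e.symm (y₀, w)) y = e.symm (y, w) := by
      intro y
      ext i
      by_cases hi : i ∈ P <;> simp [replaceBlock, happ, hi]
    have h1 := h _ hy₀
    simp only [hrep] at h1
    calc η * _ ≤ η * 1 := by gcongr; exact prob_le_one
      _ ≤ _ := by rw [mul_one]; convert h1; rfl

/-- Lower bound for the Gaussian measure of the event that one coordinate is in a short interval
and the remaining ones are not too long. -/
lemma le_pi_gaussian_slab {n : ℕ} (i₀ : Fin n) (Q : Finset (Fin n)) (h0 : i₀ ∉ Q) {δ : ℝ}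
    (hδ0 : 0 ≤ δ) (hδ1 : δ ≤ 1) :
    δ * gaussianPDFReal 0 1 1 / 2 ≤ (Measure.pi (fun _ : Fin n => gaussianReal 0 1)).real
      {x | x i₀ ∈ Set.Icc 0 δ ∧ ∑ i ∈ Q, x i ^ 2 ≤ 2 * n} := by
  have hn : (0 : ℝ) < n := by exact_mod_cast i₀.pos
  set μ := Measure.pi (fun _ : Fin n => gaussianReal 0 1) with hμ
  have hmp : ∀ i, MeasurePreserving (fun x : Fin n → ℝ => x i) μ (gaussianReal 0 1) := fun i =>
    measurePreserving_eval _ i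
  set A : Set (Fin n → ℝ) := {x | x i₀ ∈ Set.Icc 0 δ} with hA
  set G : Set (Fin n → ℝ) := {x | x i₀ ∈ Set.Icc 0 δ ∧ ∑ i ∈ Q, x i ^ 2 ≤ 2 * n} with hG
  have hAm : MeasurableSet A := measurable_pi_apply i₀ measurableSet_Icc
  have hGm : MeasurableSet G := by
    have : G = A ∩ {x | ∑ i ∈ Q, x i ^ 2 ≤ 2 * n} := rfl
    rw [this]
    exact hAm.inter (measurableSet_le (by fun_prop) (by fun_prop))
  have hAval : δ * gaussianPDFReal 0 1 1 ≤ μ.real A := by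
    have e : μ.real A = (gaussianReal 0 1).real (Set.Icc 0 δ) := by
      rw [measureReal_def, measureReal_def,
        ← (hmp i₀).measure_preimage measurableSet_Icc.nullMeasurableSet]
      rfl
    rw [e, measureReal_def, gaussianReal_apply_eq_integral _ one_ne_zero,
      ENNReal.toReal_ofReal (integral_nonneg fun x => gaussianPDFReal_nonneg _ _ _)]
    have hc : ∫ _ in Set.Icc 0 δ, gaussianPDFReal 0 1 1 = δ * gaussianPDFReal 0 1 1 := by
      rw [setIntegral_const, Real.volume_real_Icc_of_le hδ0, smul_eq_mul, sub_zero]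
    rw [← hc]
    refine setIntegral_mono_on (integrableOn_const (by simp))
      (integrable_gaussianPDFReal 0 1).integrableOn measurableSet_Icc fun x hx => ?_
    simp only [gaussianPDFReal]
    gcongr _ * Real.exp ?_
    push_cast
    nlinarith [hx.1, hx.2]
  have hsq1 : ∀ i, ∫ x, x i ^ 2 ∂μ = 1 := by
    intro i
    have hv := variance_fun_id_gaussianReal (μ := 0) (v := 1)
    rw [variance_of_integral_eq_zero (by fun_prop) (by simp), ← (hmp i).map_eq,
      integral_map (measurable_pi_apply i).aemeasurable (by fun_prop)] at hv
    simpa using hv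
  have hsqi : ∀ i, Integrable (fun x : Fin n → ℝ => x i ^ 2) μ := by
    intro i
    have h1 : Integrable (fun x : ℝ => x ^ 2) (gaussianReal 0 1) :=
      (memLp_id_gaussianReal' 2 (by simp)).integrable_sq
    exact (hmp i).integrable_comp_of_integrable h1
  have hind : iIndepFun (fun (i : Fin n) (x : Fin n → ℝ) => x i) μ :=
    iIndepFun_pi (X := fun _ x => x) fun _ => aemeasurable_id
  have hprod : ∀ i ∈ Q, ∫ x, A.indicator 1 x * x i ^ 2 ∂μ = μ.real A := by
    intro i hi
    have hne : i₀ ≠ i := fun h => h0 (h ▸ hi)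
    have h2 := (hind.indepFun hne).comp (φ := (Set.Icc 0 δ).indicator (1 : ℝ → ℝ))
      (ψ := fun x => x ^ 2) (measurable_one.indicator measurableSet_Icc) (by fun_prop)
    have h3 := h2.integral_fun_mul_eq_mul_integral
      ((measurable_one.indicator measurableSet_Icc).comp
        (measurable_pi_apply i₀)).aestronglyMeasurable
      ((measurable_id.pow_const 2).comp (measurable_pi_apply i)).aestronglyMeasurable
    have h4 : ∀ x : Fin n → ℝ, ((Set.Icc 0 δ).indicator (1 : ℝ → ℝ) ∘ fun x : Fin n → ℝ => x i₀) x =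
      A.indicator 1 x := fun x => rfl
    simp only [h4] at h3
    refine h3.trans ?_
    rw [integral_indicator_one hAm]
    simp only [Function.comp_apply]
    rw [hsq1 i, mul_one]
  have hAi : Integrable (A.indicator (1 : (Fin n → ℝ) → ℝ)) μ :=
    (integrable_const (1 : ℝ)).indicator hAm
  have hGi : Integrable (G.indicator (1 : (Fin n → ℝ) → ℝ)) μ :=
    (integrable_const (1 : ℝ)).indicator hGm
  have hAsq : ∀ i, Integrable (fun x => A.indicator (1 : (Fin n → ℝ) → ℝ) x * x i ^ 2) μ := by
    intro i
    refine ((hsqi i).indicator hAm).congr (Filter.Eventually.of_forall fun x => ?_)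
    by_cases hx : x ∈ A <;> simp [hx]
  -- Markov's inequality restricted to `A`. By independence of `x i₀` from the block `Q`, the right
  -- side integrates to at most half of the measure of `A`.
  have hpt : ∀ x, A.indicator (1 : (Fin n → ℝ) → ℝ) x - G.indicator 1 x ≤
      (2 * (n : ℝ))⁻¹ * ∑ i ∈ Q, A.indicator (1 : (Fin n → ℝ) → ℝ) x * x i ^ 2 := by
    intro x
    rw [← Finset.mul_sum]
    have hnn : 0 ≤ ∑ i ∈ Q, x i ^ 2 := Finset.sum_nonneg fun i _ => sq_nonneg _
    by_cases hx : x ∈ A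
    · by_cases hx2 : x ∈ G
      · rw [Set.indicator_of_mem hx, Set.indicator_of_mem hx2]
        simp only [Pi.one_apply, sub_self, one_mul]
        positivity
      · rw [Set.indicator_of_mem hx, Set.indicator_of_notMem hx2]
        simp only [Pi.one_apply, sub_zero, one_mul]
        have : 2 * (n : ℝ) < ∑ i ∈ Q, x i ^ 2 := by
          by_contra hcon
          exact hx2 ⟨hx, not_lt.1 hcon⟩
        rw [le_inv_mul_iff₀ (by positivity), mul_one]
        exact this.le
    · have hx2 : x ∉ G := fun h => hx h.1
      rw [Set.indicator_of_notMem hx, Set.indicator_of_notMem hx2]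
      simp
  have hint := integral_mono (hAi.sub hGi)
    ((integrable_finsetSum Q fun i _ => hAsq i).const_mul (2 * (n : ℝ))⁻¹) hpt
  rw [integral_sub' hAi hGi, integral_const_mul, integral_finsetSum _ fun i _ => hAsq i,
    Finset.sum_congr rfl hprod, integral_indicator_one hAm, integral_indicator_one hGm,
    Finset.sum_const, nsmul_eq_mul] at hint
  have hcard : (Q.card : ℝ) ≤ n := by
    have := Finset.card_le_univ Q
    rw [Fintype.card_fin] at this
    exact_mod_cast this
  have h5 : (2 * (n : ℝ))⁻¹ * (Q.card * μ.real A) ≤ μ.real A / 2 := by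
    rw [inv_mul_le_iff₀ (by positivity)]
    have := mul_le_mul_of_nonneg_right hcard (measureReal_nonneg (μ := μ) (s := A))
    linarith
  linarith

end Slicing

/-! ### Few facets force a large distance from the truncated cone. -/

section LowerBound

lemma blockNorm_replaceBlock {n : ℕ} (P : Finset (Fin n)) (x : Fin n → ℝ) (y : {i // i ∈ P} → ℝ) :
    blockNorm P (WithLp.toLp 2 (replaceBlock P x y)) =
      ‖(WithLp.toLp 2 y : EuclideanSpace ℝ {i // i ∈ P})‖ := by
  rw [EuclideanSpace.norm_eq, blockNorm]
  congr 1
  rw [← Finset.sum_coe_sort P]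
  refine Finset.sum_congr rfl fun i _ => ?_
  simp [replaceBlock]

lemma blockNorm_replaceBlock_of_disjoint {n : ℕ} {P Q : Finset (Fin n)} (h : Disjoint P Q)
    (x : Fin n → ℝ) (y : {i // i ∈ P} → ℝ) :
    blockNorm Q (WithLp.toLp 2 (replaceBlock P x y)) = √(∑ i ∈ Q, x i ^ 2) := by
  rw [blockNorm]
  congr 1
  refine Finset.sum_congr rfl fun i hi => ?_
  have : i ∉ P := Finset.disjoint_right.1 h hi
  simp [replaceBlock, this]

/-- Fixing coordinates turns each halfspace into one on the block with the same index, so `m` does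
not grow. The restricted normals may be zero, so the result is stated with `polyhedron`. -/
lemma exists_slice_polyhedron {n m : ℕ} (P : Finset (Fin n)) (x : Fin n → ℝ)
    (u : Fin m → EuclideanSpace ℝ (Fin n)) (r : Fin m → ℝ) :
    ∃ (u' : Fin m → EuclideanSpace ℝ {i // i ∈ P}) (r' : Fin m → ℝ), ∀ y,
      WithLp.toLp 2 (replaceBlock P x y) ∈ ⋂ i, halfspace (u i) (r i) ↔
        WithLp.toLp 2 y ∈ polyhedron u' r' := by
  classical
  refine ⟨fun j => WithLp.toLp 2 fun i => u j i.1,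
    fun j => r j - ∑ i ∈ Finset.univ \ P, u j i * x i, fun y => ?_⟩
  simp only [Set.mem_iInter, halfspace, polyhedron, Set.mem_ofPred_eq]
  refine forall_congr' fun j => ?_
  have e : inner ℝ (u j) (WithLp.toLp 2 (replaceBlock P x y)) =
      inner ℝ (WithLp.toLp 2 fun i => u j i.1 : EuclideanSpace ℝ {i // i ∈ P}) (WithLp.toLp 2 y) +
        ∑ i ∈ Finset.univ \ P, u j i * x i := by
    rw [PiLp.inner_apply, PiLp.inner_apply, ← Finset.sum_sdiff (Finset.subset_univ P), add_comm]
    congr 1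
    · rw [← Finset.sum_coe_sort P]
      refine Finset.sum_congr rfl fun i _ => ?_
      simp [replaceBlock]
    · refine Finset.sum_congr rfl fun i hi => ?_
      have : i ∉ P := (Finset.mem_sdiff.1 hi).2
      simp [replaceBlock, this, mul_comm]
  rw [e, le_sub_iff_add_le]

/-- A polyhedron with few facets is far from a truncated cone. -/
lemma le_gaussianDist_truncatedCone {c η : ℝ} (hc : 0 < c) (hη : 0 < η)
    (hball : ∀ (ι : Type) [Fintype ι] [Nonempty ι] (ρ : ℝ),
      (Fintype.card ι : ℝ) - c * √(Fintype.card ι) ≤ ρ ^ 2 → ρ ^ 2 ≤ Fintype.card ι → 0 ≤ ρ →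
      ∀ (m : ℕ) (u : Fin m → EuclideanSpace ℝ ι) (r : Fin m → ℝ),
        (stdGaussian (EuclideanSpace ℝ ι)).real
          (symmDiff {x | ‖x‖ ≤ ρ} (polyhedron u r)) ≤ η →
        c * √(Fintype.card ι) ≤
          Real.exp 2 * (2 * √(Real.log m) + 1) * (2 * √(Real.log m)) + 1)
    {n k m : ℕ} {i₀ : Fin n} {P Q : Finset (Fin n)} (h0P : i₀ ∉ P) (h0Q : i₀ ∉ Q)
    (hPQ : Disjoint P Q) (hk : P.card = k) (hk4 : 4 ≤ k) {a a' b' : ℝ} (ha0 : 0 ≤ a) (ha1 : a ≤ 1)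
    (ha'1 : a' ≤ 1) (hb'0 : 0 ≤ b') (hb' : b' * √(2 * n) ≤ 1 / 2)
    {L : Set (EuclideanSpace ℝ (Fin n))} (hL : IsInterOfHalfspaces m L)
    (hm : Real.exp 2 * (2 * √(Real.log m) + 1) * (2 * √(Real.log m)) + 1 < c * √k) :
    η * (min (c / 2) 1 / √k * gaussianPDFReal 0 1 1 / 2) ≤
      gaussianDist (truncatedCone i₀ P Q a (1 / √k) a' b') L := by
  obtain ⟨u, r, -, rfl⟩ := hL
  set L := ⋂ i, halfspace (u i) (r i) with hLdef
  set K := truncatedCone i₀ P Q a (1 / √k) a' b' with hK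
  have hk4' : (4 : ℝ) ≤ k := by exact_mod_cast hk4
  set s : ℝ := √k with hs
  have hs2 : s ^ 2 = k := Real.sq_sqrt (by positivity)
  have hs_ge : 2 ≤ s := Real.le_sqrt_of_sq_le (by linarith)
  -- With `2 * τ ≤ c`, a radius of at least `√k - τ` has square at least `k - c * √k`, as `hball`
  -- requires; `τ ≤ 1` yields `δ ≤ 1 / 2`.
  set τ : ℝ := min (c / 2) 1 with hτ
  have hτ0 : 0 < τ := by positivity
  have hτ1 : τ ≤ 1 := min_le_right _ _
  have hτc : 2 * τ ≤ c := by
    have : τ ≤ c / 2 := min_le_left _ _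
    linarith
  set δ : ℝ := τ / s with hδ
  have hδ0 : 0 ≤ δ := by positivity
  have hδs : δ * s = τ := by rw [hδ]; field_simp
  have hδ2 : δ ≤ 1 / 2 := by rw [hδ, div_le_iff₀ (by linarith)]; linarith
  set G : Set (Fin n → ℝ) := {x | x i₀ ∈ Set.Icc 0 δ ∧ ∑ i ∈ Q, x i ^ 2 ≤ 2 * n} with hG
  have hGm : MeasurableSet G := by
    have : G = {x : Fin n → ℝ | x i₀ ∈ Set.Icc 0 δ} ∩
        {x : Fin n → ℝ | ∑ i ∈ Q, x i ^ 2 ≤ 2 * n} := rfl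
    rw [this]
    exact (measurable_pi_apply i₀ measurableSet_Icc).inter
      (measurableSet_le (by fun_prop) (by fun_prop))
  have hLm : MeasurableSet L := by
    refine MeasurableSet.iInter fun i => ?_
    exact measurableSet_le (by fun_prop) (by fun_prop)
  have hKL : MeasurableSet (symmDiff K L) := isClosed_truncatedCone.measurableSet.symmDiff hLm
  have htoLp : Measurable (WithLp.toLp 2 : (Fin n → ℝ) → EuclideanSpace ℝ (Fin n)) := by fun_prop
  have hslice : ∀ x ∈ G, ENNReal.ofReal η ≤ Measure.pi (fun _ : {i // i ∈ P} => gaussianReal 0 1)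
      {y | replaceBlock P x y ∈ (WithLp.toLp 2 : (Fin n → ℝ) → EuclideanSpace ℝ (Fin n)) ⁻¹'
        symmDiff K L} := by
    rintro x ⟨⟨hx0, hxδ⟩, hxQ⟩
    obtain ⟨u', r', hu'⟩ := exists_slice_polyhedron P x u r
    have hcard : Fintype.card {i // i ∈ P} = k := by rw [Fintype.card_coe, hk]
    have hne : Nonempty {i // i ∈ P} := Fintype.card_pos_iff.1 (by omega)
    set ρ : ℝ := s * (1 - a * x i₀) with hρ
    have hax : a * x i₀ ≤ δ := (mul_le_of_le_one_left hx0 ha1).trans hxδ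
    have hax0 : 0 ≤ a * x i₀ := mul_nonneg ha0 hx0
    have hρlow : s - τ ≤ ρ := by
      rw [hρ, ← hδs]
      nlinarith
    have hρup : ρ ≤ s := by rw [hρ]; nlinarith
    have hρ0 : 0 ≤ ρ := by linarith
    have hnot := mt (hball {i // i ∈ P} ρ (by rw [hcard, ← hs, ← hs2]; nlinarith)
      (by rw [hcard, ← hs2]; gcongr) hρ0 m u' r') (by rw [hcard]; exact not_le.2 hm)
    rw [not_le] at hnot
    have hset : {y | replaceBlock P x y ∈ (WithLp.toLp 2 :
        (Fin n → ℝ) → EuclideanSpace ℝ (Fin n)) ⁻¹' symmDiff K L} =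
        (WithLp.toLp 2 : ({i // i ∈ P} → ℝ) → EuclideanSpace ℝ {i // i ∈ P}) ⁻¹'
          symmDiff {x | ‖x‖ ≤ ρ} (polyhedron u' r') := by
      ext y
      have hKy : WithLp.toLp 2 (replaceBlock P x y) ∈ K ↔
          ‖(WithLp.toLp 2 y : EuclideanSpace ℝ {i // i ∈ P})‖ ≤ ρ := by
        have h0 : replaceBlock P x y i₀ = x i₀ := by
          simp [replaceBlock, h0P]
        simp only [hK, truncatedCone, Set.mem_ofPred_eq, h0, blockNorm_replaceBlock,
          blockNorm_replaceBlock_of_disjoint hPQ]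
        have e1 : -x i₀ ≤ 1 := by linarith
        -- The constraint on `Q` is inactive over `G`: each summand is at most `1 / 2`.
        have e3 : a' * x i₀ + b' * √(∑ i ∈ Q, x i ^ 2) ≤ 1 := by
          have h1 : a' * x i₀ ≤ x i₀ := mul_le_of_le_one_left hx0 ha'1
          have h2 : b' * √(∑ i ∈ Q, x i ^ 2) ≤ b' * √(2 * n) := by gcongr
          linarith
        have e2 : a * x i₀ + 1 / s * ‖(WithLp.toLp 2 y : EuclideanSpace ℝ {i // i ∈ P})‖ ≤ 1 ↔
            ‖(WithLp.toLp 2 y : EuclideanSpace ℝ {i // i ∈ P})‖ ≤ ρ := by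
          rw [← le_sub_iff_add_le', one_div, inv_mul_le_iff₀ (by linarith)]
        rw [e2]
        exact ⟨fun h => h.2.1, fun h => ⟨e1, h, e3⟩⟩
      simp only [Set.mem_ofPred_eq, Set.mem_preimage, Set.mem_symmDiff, hKy, hLdef, hu' y]
    rw [hset]
    rw [measureReal_def, ← map_pi_eq_stdGaussian, Measure.map_apply (by fun_prop)
      ((measurableSet_le (by fun_prop) (by fun_prop)).symmDiff
        (measurableSet_polyhedron u' r'))] at hnot
    exact (ENNReal.ofReal_le_iff_le_toReal (by finiteness)).2 hnot.le
  have hmain := mul_pi_le_pi_of_slices P (htoLp hKL) hGm (ENNReal.ofReal η) hslice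
  have hreal := ENNReal.toReal_mono (by finiteness) hmain
  rw [ENNReal.toReal_mul, ENNReal.toReal_ofReal hη.le] at hreal
  rw [gaussianDist, measureReal_def, ← map_pi_eq_stdGaussian, Measure.map_apply htoLp hKL]
  refine le_trans ?_ hreal
  gcongr
  exact le_pi_gaussian_slab i₀ Q h0Q hδ0 (by linarith)

end LowerBound

/-! ### Choice of parameters and conclusion. -/

/-- The square roots are absorbed by `2 * √ℓ ≤ ℓ + 1`, and the assumption on `c * y` lets the
additive constants use up at most half of the left side. -/
lemma le_of_le_exp_two_mul_sqrt {c y ℓ : ℝ} (hy : 8 * Real.exp 2 ≤ c * y) (hℓ : 0 ≤ ℓ)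
    (h : c * y / 2 ≤ Real.exp 2 * (2 * √ℓ + 1) * (2 * √ℓ) + 1) :
    c * y / (20 * Real.exp 2) ≤ ℓ := by
  have hs : √ℓ ^ 2 = ℓ := Real.sq_sqrt hℓ
  set e := Real.exp 2 with he
  have he1 : 1 ≤ e := Real.one_le_exp (by norm_num)
  have h1 : (2 * √ℓ + 1) * (2 * √ℓ) ≤ 5 * ℓ + 1 := by nlinarith [sq_nonneg (√ℓ - 1)]
  have h2 : e * ((2 * √ℓ + 1) * (2 * √ℓ)) ≤ e * (5 * ℓ + 1) := by gcongr
  rw [div_le_iff₀ (by positivity)]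
  nlinarith

lemma exists_truncatedCone_parameters {n k : ℕ} (hk : 4 ≤ k) (hn : k + 2 ≤ n) :
    ∃ (i₀ : Fin n) (P Q : Finset (Fin n)) (a a' b' : ℝ), (∀ i, i = i₀ ∨ i ∈ P ∨ i ∈ Q) ∧
      i₀ ∉ P ∧ i₀ ∉ Q ∧ Disjoint P Q ∧ Q.Nonempty ∧ P.card = k ∧
      0 < a ∧ a ≤ 1 ∧ 0 < a' ∧ a' ≤ 1 ∧ 0 < b' ∧ b' * √(2 * n) ≤ 1 / 2 ∧
      a ^ 2 + (1 / √k) ^ 2 = 1 ∧ a' ^ 2 + b' ^ 2 = 1 := by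
  have hk' : (4 : ℝ) ≤ k := by exact_mod_cast hk
  have hn' : (6 : ℝ) ≤ n := by exact_mod_cast (by omega : 6 ≤ n)
  set s : ℝ := √(2 * n) with hs
  have hs2 : s ^ 2 = 2 * n := Real.sq_sqrt (by positivity)
  have hs0 : 0 < s := by positivity
  have hsqrt : ∀ b : ℝ, b ^ 2 ≤ 1 / 4 → 0 < √(1 - b ^ 2) ∧ √(1 - b ^ 2) ≤ 1 ∧
      √(1 - b ^ 2) ^ 2 + b ^ 2 = 1 := fun b hb =>
    ⟨Real.sqrt_pos.2 (by linarith), Real.sqrt_le_one.2 (by linarith [sq_nonneg b]), by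
      rw [Real.sq_sqrt (by linarith)]; ring⟩
  have hb : (1 / √(k : ℝ)) ^ 2 ≤ 1 / 4 := by
    rw [div_pow, Real.sq_sqrt (by positivity), one_pow]
    gcongr
  have hb' : (1 / (2 * s)) ^ 2 ≤ 1 / 4 := by
    rw [div_pow, one_pow, mul_pow, hs2]
    gcongr
    linarith
  obtain ⟨ha1, ha2, ha3⟩ := hsqrt _ hb
  obtain ⟨ha1', ha2', ha3'⟩ := hsqrt _ hb'
  refine ⟨⟨0, by omega⟩, Finset.univ.filter fun i => 1 ≤ i.val ∧ i.val ≤ k,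
    Finset.univ.filter fun i => k < i.val, _, _, 1 / (2 * s), fun i => ?_, by simp, by simp, ?_,
    ⟨⟨k + 1, by omega⟩, by simp⟩, ?_, ha1, ha2, ha1', ha2', by positivity, ?_, ha3, ha3'⟩
  · simp only [Finset.mem_filter, Finset.mem_univ, true_and, Fin.ext_iff]
    omega
  · rw [Finset.disjoint_filter]
    intro i _ h
    omega
  · have : (Finset.univ.filter fun i : Fin n => 1 ≤ i.val ∧ i.val ≤ k) =
        Finset.Icc (⟨1, by omega⟩ : Fin n) ⟨k, by omega⟩ := by
      ext i
      simp [Fin.le_def]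
    rw [this, Fin.card_Icc]
    simp
  · apply le_of_eq
    field_simp

/-- The constants `c` and `ε₀` are absolute: they make precise the bound `2 ^ Ω(1/ε)`, which
is a bound as `ε → 0`. -/
theorem theorem6p3 :
    ∃ c : ℝ, 0 < c ∧ ∃ ε₀ : ℝ, 0 < ε₀ ∧
      ∀ ε : ℝ, 0 < ε → ε < ε₀ →
        ∃ n₀ : ℕ, ∀ n : ℕ, n₀ ≤ n →
          ∃ K : Set (EuclideanSpace ℝ (Fin n)), IsConvexBody K ∧ HasGeometricWidth K 1 ∧
            ∀ L : Set (EuclideanSpace ℝ (Fin n)), gaussianDist K L ≤ ε →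
              ∀ m : ℕ, IsInterOfHalfspaces m L → (2 : ℝ) ^ (c / ε) ≤ (m : ℝ) := by
  obtain ⟨c, η, hc, hη, hball⟩ := exists_ball_approximation_bound
  have hg : 0 < gaussianPDFReal 0 1 1 := gaussianPDFReal_pos _ _ _ one_ne_zero
  set A : ℝ := η * (min (c / 2) 1 * gaussianPDFReal 0 1 1 / 2) with hA
  have hA0 : 0 < A := by positivity
  set y₀ : ℝ := max 2 (8 * Real.exp 2 / c) with hy₀
  have hy₀0 : 0 < y₀ := by positivity
  refine ⟨c * A / (40 * Real.exp 2), by positivity, A / (2 * y₀), by positivity,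
    fun ε hε hε₀ => ?_⟩
  -- For a polyhedron violating the logarithmic bound, the distance is at least `A / √k`. The factor
  -- `2` makes this at least `2 * ε` when `√k ≤ y`, which is the contradiction in `hlog`.
  set y : ℝ := A / (2 * ε) with hy
  have hyy₀ : y₀ ≤ y := by
    rw [lt_div_iff₀ (by positivity)] at hε₀
    rw [hy, le_div_iff₀ (by positivity)]
    linarith
  have hy2 : 2 ≤ y := (le_max_left _ _).trans hyy₀
  have hyc : 8 * Real.exp 2 ≤ c * y := by
    have := (le_max_right 2 (8 * Real.exp 2 / c)).trans hyy₀
    rw [div_le_iff₀ hc] at this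
    linarith
  set k : ℕ := ⌊y ^ 2⌋₊ with hk
  have hk4 : 4 ≤ k := Nat.le_floor (by push_cast; nlinarith)
  have hky : √(k : ℝ) ≤ y := Real.sqrt_le_iff.2 ⟨by linarith, Nat.floor_le (by positivity)⟩
  have hyk : y / 2 ≤ √(k : ℝ) := by
    apply Real.le_sqrt_of_sq_le
    have := Nat.lt_floor_add_one (y ^ 2)
    rw [← hk] at this
    nlinarith
  have hk0 : 0 < √(k : ℝ) := by linarith
  refine ⟨k + 2, fun n hn => ?_⟩
  obtain ⟨i₀, P, Q, a, a', b', hcover, h0P, h0Q, hPQ, hQ, hPk, ha0, ha1, ha'0, ha'1, hb'0, hb'1,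
    hab, hab'⟩ := exists_truncatedCone_parameters hk4 hn
  have hP : P.Nonempty := Finset.card_pos.1 (by omega)
  obtain ⟨hbody, hwidth⟩ := truncatedCone_isConvexBody_and_hasGeometricWidth (b := 1 / √(k : ℝ))
    hcover h0P h0Q hP hQ ha0 (by positivity) hab ha'0 hb'0 hab'
  refine ⟨_, hbody, hwidth, fun L hKL m hL => ?_⟩
  have hlog : c * √(k : ℝ) ≤
      Real.exp 2 * (2 * √(Real.log m) + 1) * (2 * √(Real.log m)) + 1 := by
    by_contra hcon
    have h1 := (le_gaussianDist_truncatedCone hc hη hball h0P h0Q hPQ hPk hk4 ha0.le ha1 ha'1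
      hb'0.le hb'1 hL (not_le.1 hcon)).trans hKL
    have h2 : A / √(k : ℝ) ≤ ε := by
      refine le_trans (le_of_eq ?_) h1
      rw [hA]; ring
    rw [div_le_iff₀ hk0] at h2
    have h3 : ε * √(k : ℝ) ≤ ε * y := by gcongr
    have h4 : ε * y = A / 2 := by rw [hy]; field_simp
    linarith
  have hℓ0 : 0 ≤ Real.log m := Real.log_natCast_nonneg m
  have hfin := le_of_le_exp_two_mul_sqrt hyc hℓ0 (le_trans (by nlinarith) hlog)
  -- Since `Real.log 0 = 0`, this also rules out `m = 0`.
  have hpos : 0 < Real.log m := lt_of_lt_of_le (by positivity) hfin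
  have hm0 : (0 : ℝ) < m := by
    rcases Nat.eq_zero_or_pos m with h | h
    · rw [h] at hpos; simp at hpos
    · exact_mod_cast h
  rw [Real.rpow_def_of_pos two_pos, ← Real.le_log_iff_exp_le hm0]
  refine le_trans ?_ hfin
  have e : c * A / (40 * Real.exp 2) / ε = c * y / (20 * Real.exp 2) := by
    rw [hy]; field_simp; norm_num
  rw [e]
  have hlog2 : Real.log 2 ≤ 1 := by
    have := Real.log_two_lt_d9
    linarith
  exact mul_le_of_le_one_left (by positivity) hlog2
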